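/- Notation: $\mathbb{N}=\{1,2,\dots\}$ and $\varrho(x)=\max\{0,x\}$. A (ReLU) network is a tuple $\Phi=((A_1,b_1),\dots,(A_L,b_L))$, $L\ge 1$, with $A_j\in\mathbb{R}^{N_j\times N_{j-1}}$, $b_j\in\mathbb{R}^{N_j}$, $N_j\in\mathbb{N}$. It computes $R_\varrho\Phi=T_L\circ(\varrho\circ T_{L-1})\circ\cdots\circ(\varrho\circ T_1)$, where $T_jx=A_jx+b_j$ and $\varrho$ acts componentwise. Let $L(\Phi)=L$, let $W(\Phi)$ be the total number of nonzero entries of all $A_j,b_j$, and let $\|\Phi\|$ be the largest absolute value of these entries. Let $d\in\mathbb{N}$, $\alpha\in(0,\infty)$, and let $\ell:\mathbb{N}\to\mathbb{N}_{\ge2}\cup\{\infty\}$ and $c:\mathbb{N}\to\mathbb{N}\cup\{\infty\}$ be non-decreasing. Let $\Sigma_n$ be the set of all functions $R_\varrho\Phi:\mathbb{R}^d\to\mathbb{R}$ with $W(\Phi)\le n$, $L(\Phi)\le\ell(n)$, $\|\Phi\|\le c(n)$. For measurable $f$ on $[0,1]^d$ put $$\Gamma(f)=\max\Big\{\|f\|_{L^\infty},\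 \sup_{n\in\mathbb{N}} n^\alpha\inf_{g\in\Sigma_n}\|f-g\|_{L^\infty}\Big\},\qquad \|f\|_{A^{\alpha,\infty}_{\ell,c}}=\inf\{t>0:\Gamma(f/t)\le1\},$$ with $L^\infty=L^\infty([0,1]^d)$. Functions with $\|f\|_{A^{\alpha,\infty}_{\ell,c}}<\infty$ have a unique continuous representative, and point values refer to it. Let $U=\{f:\|f\|_{A^{\alpha,\infty}_{\ell,c}}\le1\}$. For $m\in\mathbb{N}$, $\mathrm{Alg}_m(U)$ is the set of maps $A:U\to L^\infty$ of the form $A(f)=Q(f(x_1),\dots,f(x_m))$ with $x_1,\dots,x_m\in[0,1]^d$ and an arbitrary map $Q:\mathbb{R}^m\to L^\infty$. A randomized algorithm using $m$ samples is a family $(A_\omega)_{\omega\in\Omega}$ of maps $U\to L^\infty$ indexed by a probability space, together with a measurable $\mathbf{m}:\Omega\to\mathbb{N}$, such that $\omega\mapsto A_\omega(f)$ is Borel measurable for each $f\in U$, $A_\omega\in\mathrm{Alg}_{\mathbf{m}(\omega)}(U)$ for all $\omega$, and $\mathbb{E}[\mathbf{m}]\le m$. Let $$e^{\mathrm{det}}_m=\inf_{A\in\mathrm{Alg}_m(U)}\sup_{f\in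 U}\|A(f)-f\|_{L^\infty},\qquad e^{\mathrm{MC}}_m=\inf_{(A_\omega),\mathbf{m}}\ \sup_{f\in U}\mathbb{E}\,\|A_\omega(f)-f\|_{L^\infty},$$ the second infimum being over all randomized algorithms using $m$ samples, and for $\bullet\in\{\mathrm{det},\mathrm{MC}\}$ let $$\beta^{\bullet}_*(U)=\sup\{\lambda\ge0:\exists C>0\ \forall m\in\mathbb{N}:\ e^{\bullet}_m\le C m^{-\lambda}\}.$$ For $m\ge2^d$ put $n=\lfloor m^{1/d}\rfloor-1$ and $$A^{\mathrm{pw\text{-}const}}_m(f)=\sum_{i\in\{0,\dots,n\}^d}f(i/n)\,\mathbb{1}_{i/n+[0,1/n)^d}.$$ **Theorem.** Assume that there are $\theta\ge0$, $\kappa\in\mathbb{R}$ and constants $C_1,C_2>0$ with $C_1 n^\theta(\ln(2n))^\kappa\le c(n)\le C_2 n^\theta(\ln(2n))^\kappa$ for all $n\in\mathbb{N}$. Let $\ell^*=\sup_n\ell(n)$ and assume $\ell^*\ge3$. If $\ell^*<\infty$, let $\gamma^*=\theta\ell^*+\lfloor\ell^*/2\rfloor$. Then $A^{\mathrm{pw\text{-}const}}_m\in\mathrm{Alg}_m(U)$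 for all $m\ge2^d$, and $$\sup\Big\{\lambda\ge0:\exists C>0\ \forall m\ge2^d:\ \sup_{f\in U}\|A^{\mathrm{pw\text{-}const}}_m(f)-f\|_{L^\infty}\le Cm^{-\lambda}\Big\}=\beta^{\mathrm{det}}_*(U)=\beta^{\mathrm{MC}}_*(U)=\begin{cases}\frac1d\cdot\frac{\alpha}{\gamma^*+\alpha}&\text{if }\ell^*<\infty,\\0&\text{if }\ell^*=\infty.\end{cases}$$ -/

import Mathlib

open MeasureTheory
open scoped ENNReal NNReal

universe u

noncomputable section

namespace NNApprox

/-! ### ReLU neural networks -/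

/-- A neural network with input dimension `i` and output dimension `o`: a nonempty tuple
`((A₁, b₁), …, (A_L, b_L))` of weight matrices and bias vectors with matching sizes.
`last A b` is a network with the single layer `(A, b)`; `layer A b Φ` puts the layer `(A, b)`
in front of `Φ`. Widths of hidden layers are positive. -/
inductive Network : ℕ → ℕ → Type
  | last {i o : ℕ} (A : Matrix (Fin o) (Fin i) ℝ) (b : Fin o → ℝ) : Network i o
  | layer {i h o : ℕ} (hh : 0 < h) (A : Matrix (Fin h) (Fin i) ℝ) (b : Fin h → ℝ)
      (Φ : Network h o) : Network i o

/-- The number of nonzero entries of a matrix. -/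
def matrixNnz {k l : ℕ} (A : Matrix (Fin k) (Fin l) ℝ) : ℕ :=
  (Finset.univ.filter fun q : Fin k × Fin l => A q.1 q.2 ≠ 0).card

/-- The number of nonzero entries of a vector. -/
def vecNnz {k : ℕ} (b : Fin k → ℝ) : ℕ :=
  (Finset.univ.filter fun q : Fin k => b q ≠ 0).card

/-- The largest absolute value of an entry of a matrix (`0` for an empty matrix). -/
def matrixMax {k l : ℕ} (A : Matrix (Fin k) (Fin l) ℝ) : ℝ≥0 :=
  Finset.univ.sup fun q : Fin k × Fin l => ‖A q.1 q.2‖₊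

/-- The largest absolute value of an entry of a vector (`0` for an empty vector). -/
def vecMax {k : ℕ} (b : Fin k → ℝ) : ℝ≥0 :=
  Finset.univ.sup fun q : Fin k => ‖b q‖₊

namespace Network

/-- The number `L(Φ)` of layers. -/
def depth : {i o : ℕ} → Network i o → ℕ
  | _, _, last _ _ => 1
  | _, _, layer _ _ _ Φ => Φ.depth + 1

/-- The number `W(Φ)` of nonzero weights. -/
def numWeights : {i o : ℕ} → Network i o → ℕ
  | _, _, last A b => matrixNnz A + vecNnz b
  | _, _, layer _ A b Φ => matrixNnz A + vecNnz b + Φ.numWeights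

/-- The maximal absolute value of a weight of `Φ`. -/
def weightSize : {i o : ℕ} → Network i o → ℝ≥0
  | _, _, last A b => max (matrixMax A) (vecMax b)
  | _, _, layer _ A b Φ => max (max (matrixMax A) (vecMax b)) Φ.weightSize

/-- The function computed by `Φ` with activation function `x ↦ max 0 x`, applied
componentwise after every layer except the last. -/
def realize : {i o : ℕ} → Network i o → (Fin i → ℝ) → (Fin o → ℝ)
  | _, _, last A b => fun x => A.mulVec x + b
  | _, _, layer _ A b Φ => fun x => Φ.realize fun k => max 0 ((A.mulVec x + b) k)

theorem continuous_realize {i o : ℕ} (Φ : Network i o) : Continuous Φ.realize := by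
  induction Φ with
  | last A b =>
    have : Continuous fun x => A.mulVec x + b := by fun_prop
    exact this
  | layer hh A b Φ ih =>
    have : Continuous fun x => (fun k => max 0 ((A.mulVec x + b) k)) := by fun_prop
    exact ih.comp this

end Network

/-! ### Neural network approximation spaces on the unit cube -/

/-- The unit cube `[0,1]^d`. -/
def cube (d : ℕ) : Set (Fin d → ℝ) := Set.Icc 0 1

/-- Lebesgue measure on the unit cube. -/
def cubeMeasure (d : ℕ) : Measure (Fin d → ℝ) := volume.restrict (cube d)

instance (d : ℕ) : IsFiniteMeasure (cubeMeasure d) :=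
  ⟨by
    rw [cubeMeasure, Measure.restrict_apply_univ]
    exact isCompact_Icc.measure_lt_top⟩

/-- The set `Σ_n` of functions computed by networks with input dimension `d`, output
dimension `1`, at most `n` nonzero weights, at most `ℓ n` layers, and weights of absolute
value at most `c n`. -/
def networkFunctions (d : ℕ) (ℓ c : ℕ → ℕ∞) (n : ℕ) : Set ((Fin d → ℝ) → ℝ) :=
  {g | ∃ Φ : Network d 1, Φ.numWeights ≤ n ∧ (Φ.depth : ℕ∞) ≤ ℓ n ∧
    (Φ.weightSize : ℝ≥0∞) ≤ ((c n : ℕ∞) : ℝ≥0∞) ∧ g = fun x => Φ.realize x 0}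

/-- The quantity `Γ_{α,p}(f) = max {‖f‖_{L^p}, sup_{n ≥ 1} n^α · d_p(f, Σ_n)}`. -/
def preNorm (d : ℕ) (α : ℝ) (p : ℝ≥0∞) (ℓ c : ℕ → ℕ∞) (f : (Fin d → ℝ) → ℝ) : ℝ≥0∞ :=
  max (eLpNorm f p (cubeMeasure d))
    (⨆ n : ℕ, ⨆ _ : 1 ≤ n, (n : ℝ≥0∞) ^ α *
      ⨅ g ∈ networkFunctions d ℓ c n, eLpNorm (fun x => f x - g x) p (cubeMeasure d))

/-- The quasi-norm of the approximation space,
`‖f‖ = inf {t > 0 : Γ_{α,p}(f / t) ≤ 1}`. -/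
def approxNorm (d : ℕ) (α : ℝ) (p : ℝ≥0∞) (ℓ c : ℕ → ℕ∞) (f : (Fin d → ℝ) → ℝ) : ℝ≥0∞ :=
  ⨅ t : ℝ, ⨅ _ : 0 < t ∧ preNorm d α p ℓ c (fun x => f x / t) ≤ 1, ENNReal.ofReal t

/-- The unit ball of the approximation space with `p = ∞`. A function of finite quasi-norm
agrees almost everywhere on the cube with a unique continuous function (see
`exists_continuousOn_ae_eq` and `eqOn_of_ae_eq`); point values are those of the continuous
representative. So the members are functions that are continuous on the cube. -/
def unitBall (d : ℕ) (α : ℝ) (ℓ c : ℕ → ℕ∞) : Set ((Fin d → ℝ) → ℝ) :=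
  {f | ContinuousOn f (cube d) ∧ approxNorm d α ∞ ℓ c f ≤ 1}

theorem cube_subset_closure_interior (d : ℕ) : cube d ⊆ closure (interior (cube d)) := by
  have hconv : Convex ℝ (cube d) := convex_Icc 0 1
  have hne : (interior (cube d)).Nonempty := by
    refine ⟨fun _ => 1 / 2, ?_⟩
    have h : (Set.univ.pi fun _ : Fin d => Set.Ioo (0 : ℝ) 1) ⊆ interior (cube d) := by
      refine interior_maximal ?_ (isOpen_set_pi Set.finite_univ fun _ _ => isOpen_Ioo)
      intro x hx
      exact ⟨fun i => (hx i trivial).1.le, fun i => (hx i trivial).2.le⟩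
    exact h fun _ _ => ⟨by norm_num, by norm_num⟩
  rw [hconv.closure_interior_eq_closure_of_nonempty_interior hne]
  exact subset_closure

/-- Continuous representatives are unique on the cube. -/
theorem eqOn_of_ae_eq {d : ℕ} {f g : (Fin d → ℝ) → ℝ} (hf : ContinuousOn f (cube d))
    (hg : ContinuousOn g (cube d)) (h : f =ᵐ[cubeMeasure d] g) : Set.EqOn f g (cube d) :=
  Measure.eqOn_of_ae_eq h hf hg (cube_subset_closure_interior d)

/-- For `p = ∞`, every function of finite quasi-norm has a continuous representative. -/
theorem exists_continuousOn_ae_eq {d : ℕ} {α : ℝ} (hα : 0 < α) {ℓ c : ℕ → ℕ∞}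
    {f : (Fin d → ℝ) → ℝ} (hf : approxNorm d α ∞ ℓ c f < ∞) :
    ∃ g, ContinuousOn g (cube d) ∧ f =ᵐ[cubeMeasure d] g := by
  simp only [approxNorm, iInf_lt_iff] at hf
  obtain ⟨t, ⟨ht, hpre⟩, -⟩ := hf
  set μ := cubeMeasure d with hμ
  -- choose network functions that converge to `f / t` in the `L^∞` norm
  have key : ∀ k : ℕ, ∃ g : (Fin d → ℝ) → ℝ, Continuous g ∧
      ∀ᵐ x ∂μ, |f x / t - g x| ≤ 2 * ((k + 1 : ℕ) : ℝ) ^ (-α) := by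
    intro k
    have hk0 : (0 : ℝ) < ((k + 1 : ℕ) : ℝ) := by positivity
    have h1 := (le_max_right _ _).trans hpre
    have h2 := (le_iSup₂ (f := fun (n : ℕ) (_ : 1 ≤ n) => (n : ℝ≥0∞) ^ α *
      ⨅ g ∈ networkFunctions d ℓ c n,
        eLpNorm (fun x => f x / t - g x) ∞ (cubeMeasure d)) (k + 1) (by omega)).trans h1
    have hpow : ((k + 1 : ℕ) : ℝ≥0∞) ^ α = ENNReal.ofReal (((k + 1 : ℕ) : ℝ) ^ α) := by
      rw [← ENNReal.ofReal_rpow_of_pos hk0, ENNReal.ofReal_natCast]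
    have h3 : (⨅ g ∈ networkFunctions d ℓ c (k + 1),
        eLpNorm (fun x => f x / t - g x) ∞ (cubeMeasure d)) <
          ENNReal.ofReal (2 * ((k + 1 : ℕ) : ℝ) ^ (-α)) := by
      by_contra hcon
      rw [not_lt] at hcon
      have h4 := (mul_le_mul_right hcon (((k + 1 : ℕ) : ℝ≥0∞) ^ α)).trans h2
      rw [hpow, ← ENNReal.ofReal_mul (by positivity), Real.rpow_neg hk0.le] at h4
      have hp : (0 : ℝ) < ((k + 1 : ℕ) : ℝ) ^ α := Real.rpow_pos_of_pos hk0 α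
      rw [show ((k + 1 : ℕ) : ℝ) ^ α * (2 * (((k + 1 : ℕ) : ℝ) ^ α)⁻¹) = 2 by
        field_simp] at h4
      norm_num at h4
    simp only [iInf_lt_iff] at h3
    obtain ⟨g, ⟨Φ, -, -, -, rfl⟩, hg⟩ := h3
    refine ⟨_, (continuous_apply 0).comp Φ.continuous_realize, ?_⟩
    rw [eLpNorm_exponent_top] at hg
    filter_upwards [ae_le_eLpNormEssSup (f := fun x => f x / t - Φ.realize x 0) (μ := μ)]
      with x hx
    have h5 := hx.trans hg.le
    rw [← ofReal_norm, ENNReal.ofReal_le_ofReal_iff (by positivity)] at h5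
    exact h5
  choose g hg hfg using key
  have hae : ∀ᵐ x ∂μ, ∀ k, |f x / t - g k x| ≤ 2 * ((k + 1 : ℕ) : ℝ) ^ (-α) :=
    ae_all_iff.2 hfg
  have hlim : Filter.Tendsto (fun k : ℕ => 2 * ((k + 1 : ℕ) : ℝ) ^ (-α)) Filter.atTop
      (nhds 0) := by
    have h := ((tendsto_rpow_neg_atTop hα).comp
      ((tendsto_natCast_atTop_atTop (R := ℝ)).comp (Filter.tendsto_add_atTop_nat 1))).const_mul 2
    simpa using h
  -- the approximants form a Cauchy sequence uniformly on the cube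
  have hdist : ∀ k l : ℕ, ∀ x ∈ cube d, |g k x - g l x| ≤
      2 * ((k + 1 : ℕ) : ℝ) ^ (-α) + 2 * ((l + 1 : ℕ) : ℝ) ^ (-α) := by
    intro k l
    set B := 2 * ((k + 1 : ℕ) : ℝ) ^ (-α) + 2 * ((l + 1 : ℕ) : ℝ) ^ (-α)
    have hcont : ContinuousOn (fun x => |g k x - g l x|) (cube d) :=
      (((hg k).sub (hg l)).abs).continuousOn
    have heq : (fun x => |g k x - g l x|) =ᵐ[μ] fun x => min |g k x - g l x| B := by
      filter_upwards [hae] with x hx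
      refine (min_eq_left ?_).symm
      have h1 := abs_le.1 (hx k)
      have h2 := abs_le.1 (hx l)
      rw [abs_le]
      constructor <;> simp only [B] <;> linarith [h1.1, h1.2, h2.1, h2.2]
    have h := eqOn_of_ae_eq hcont (ContinuousOn.inf hcont continuousOn_const) heq
    intro x hx
    have := h hx
    exact min_eq_left_iff.1 this.symm
  have hcauchy : UniformCauchySeqOn g Filter.atTop (cube d) := by
    rw [Metric.uniformCauchySeqOn_iff]
    intro ε hε
    obtain ⟨N, hN⟩ := Filter.eventually_atTop.1 (hlim.eventually (gt_mem_nhds (half_pos hε)))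
    refine ⟨N, fun k hk l hl x hx => ?_⟩
    rw [Real.dist_eq]
    linarith [hdist k l x hx, hN k hk, hN l hl]
  have hpt : ∀ x ∈ cube d, ∃ y, Filter.Tendsto (fun k => g k x) Filter.atTop (nhds y) :=
    fun x hx => cauchySeq_tendsto_of_complete (hcauchy.cauchySeq hx)
  choose! G hG using hpt
  have hunif := hcauchy.tendstoUniformlyOn_of_tendsto hG
  have hGcont : ContinuousOn G (cube d) :=
    hunif.continuousOn (Filter.Frequently.of_forall fun k => (hg k).continuousOn)
  refine ⟨fun x => t * G x, continuousOn_const.mul hGcont, ?_⟩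
  filter_upwards [hae, ae_restrict_mem (μ := volume) (measurableSet_Icc : MeasurableSet (cube d))]
    with x hx hxc
  have h1 : Filter.Tendsto (fun k => g k x) Filter.atTop (nhds (f x / t)) := by
    rw [tendsto_iff_dist_tendsto_zero]
    refine squeeze_zero (fun _ => dist_nonneg) (fun k => ?_) hlim
    rw [dist_comm, Real.dist_eq]
    exact hx k
  have h2 := tendsto_nhds_unique h1 (hG x hxc)
  rw [← h2]
  field_simp

/-! ### Sampling algorithms and convergence orders -/

/-- The space `L^∞([0,1]^d)`. -/
abbrev LInfty (d : ℕ) := Lp ℝ ∞ (cubeMeasure d)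

/-- The set `Alg_m(U)` of deterministic maps `A : U → L^∞([0,1]^d)` of the form
`A f = Q (f x₁, …, f x_m)` with sample points in the cube. -/
def Alg {d : ℕ} (U : Set ((Fin d → ℝ) → ℝ)) (m : ℕ) : Set (U → LInfty d) :=
  {A | ∃ x : Fin m → Fin d → ℝ, (∀ k, x k ∈ cube d) ∧
    ∃ Q : (Fin m → ℝ) → LInfty d, ∀ f : U, A f = Q fun k => f.1 (x k)}

/-- The distance `‖y - f‖_{L^∞([0,1]^d)}`. -/
def errorAt {d : ℕ} (y : LInfty d) (f : (Fin d → ℝ) → ℝ) : ℝ≥0∞ :=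
  eLpNorm (fun x => y x - f x) ∞ (cubeMeasure d)

/-- The worst-case error `sup_{f ∈ U} ‖A f - f‖_{L^∞}`. -/
def worstError {d : ℕ} {U : Set ((Fin d → ℝ) → ℝ)} (A : U → LInfty d) : ℝ≥0∞ :=
  ⨆ f : U, errorAt (A f) f.1

/-- The optimal worst-case error of deterministic algorithms using `m` point samples. -/
def detError {d : ℕ} (U : Set ((Fin d → ℝ) → ℝ)) (m : ℕ) : ℝ≥0∞ :=
  ⨅ A ∈ Alg U m, worstError A

/-- A randomized (Monte Carlo) algorithm using `m` point samples in expectation: a family of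
maps `A ω : U → L^∞([0,1]^d)` indexed by a probability space such that `A ω` is a
deterministic algorithm using `numSamples ω` point samples, where `numSamples` is measurable
with expectation at most `m`, and such that `ω ↦ A ω f` is Borel measurable for each `f`. -/
structure RandomizedAlg {d : ℕ} (U : Set ((Fin d → ℝ) → ℝ)) (m : ℕ) where
  Ω : Type u
  [measurableSpace : MeasurableSpace Ω]
  P : Measure Ω
  [isProbabilityMeasure : IsProbabilityMeasure P]
  A : Ω → U → LInfty d
  numSamples : Ω → ℕ
  measurable_A : ∀ f : U, @Measurable Ω (LInfty d) _ (borel (LInfty d)) fun ω => A ω f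
  measurable_numSamples : Measurable numSamples
  numSamples_pos : ∀ ω, 1 ≤ numSamples ω
  mem_alg : ∀ ω, A ω ∈ Alg U (numSamples ω)
  expectation_le : ∫⁻ ω, (numSamples ω : ℝ≥0∞) ∂P ≤ m

/-- The error `sup_{f ∈ U} E ‖A_ω f - f‖_{L^∞}` of a randomized algorithm. -/
def RandomizedAlg.error {d : ℕ} {U : Set ((Fin d → ℝ) → ℝ)} {m : ℕ}
    (R : RandomizedAlg.{u} U m) : ℝ≥0∞ :=
  letI := R.measurableSpace
  ⨆ f : U, ∫⁻ ω, errorAt (R.A ω f) f.1 ∂(R.P)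

/-- The optimal error of randomized algorithms using `m` point samples in expectation. -/
def mcError {d : ℕ} (U : Set ((Fin d → ℝ) → ℝ)) (m : ℕ) : ℝ≥0∞ :=
  ⨅ R : RandomizedAlg.{u} U m, R.error

/-- `sup {r ≥ 0 : ∃ C > 0, ∀ m ≥ m₀, e m ≤ C · m ^ (-r)}`, as an element of `[0,∞]`. -/
def convergenceOrder (m₀ : ℕ) (e : ℕ → ℝ≥0∞) : ℝ≥0∞ :=
  ⨆ r : ℝ≥0, ⨆ _ : ∃ C : ℝ, 0 < C ∧
    ∀ m : ℕ, m₀ ≤ m → e m ≤ ENNReal.ofReal (C * (m : ℝ) ^ (-(r : ℝ))), (r : ℝ≥0∞)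

/-- The optimal deterministic order. -/
def betaDet {d : ℕ} (U : Set ((Fin d → ℝ) → ℝ)) : ℝ≥0∞ :=
  convergenceOrder 1 (detError U)

/-- The optimal randomized (Monte Carlo) order. -/
def betaMC {d : ℕ} (U : Set ((Fin d → ℝ) → ℝ)) : ℝ≥0∞ :=
  convergenceOrder 1 (mcError.{u} U)

/-! ### Piecewise constant interpolation -/

/-- `n = ⌊m^{1/d}⌋ - 1`. -/
def gridSize (d m : ℕ) : ℕ := ⌊(m : ℝ) ^ (1 / (d : ℝ))⌋₊ - 1

/-- The grid point `(i₁/n, …, i_d/n)`. -/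
def gridPoint {d : ℕ} (n : ℕ) (i : Fin d → Fin (n + 1)) : Fin d → ℝ :=
  fun j => ((i j : ℕ) : ℝ) / n

/-- The cell `(i₁/n, …, i_d/n) + [0, 1/n)^d`. -/
def gridCell {d : ℕ} (n : ℕ) (i : Fin d → Fin (n + 1)) : Set (Fin d → ℝ) :=
  Set.univ.pi fun j => Set.Ico (gridPoint n i j) (gridPoint n i j + 1 / n)

/-- The function
`∑_{i ∈ {0,…,n}^d} f(i₁/n, …, i_d/n) · 1_{(i₁/n, …, i_d/n) + [0, 1/n)^d}`. -/
def pwConstFun (d m : ℕ) (f : (Fin d → ℝ) → ℝ) : (Fin d → ℝ) → ℝ :=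
  fun x => ∑ i : Fin d → Fin (gridSize d m + 1),
    (gridCell (gridSize d m) i).indicator (fun _ => f (gridPoint (gridSize d m) i)) x

theorem memLp_pwConstFun (d m : ℕ) (f : (Fin d → ℝ) → ℝ) :
    MemLp (pwConstFun d m f) ∞ (cubeMeasure d) := by
  have h : ∀ i ∈ (Finset.univ : Finset (Fin d → Fin (gridSize d m + 1))),
      MemLp ((gridCell (gridSize d m) i).indicator
        fun _ => f (gridPoint (gridSize d m) i)) ∞ (cubeMeasure d) := fun i _ =>
    (memLp_const _).indicator (MeasurableSet.univ_pi fun _ => measurableSet_Ico)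
  exact memLp_finsetSum _ h

/-- Piecewise constant interpolation `A_m^{pw-const}` on a uniform tensor-product grid. -/
def pwConst {d : ℕ} (U : Set ((Fin d → ℝ) → ℝ)) (m : ℕ) : U → LInfty d :=
  fun f => (memLp_pwConstFun d m f.1).toLp _

/-- `sup {r ≥ 0 : ∃ C > 0, ∀ m ≥ 2^d, sup_{f ∈ U} ‖A_m^{pw-const} f - f‖_{L^∞} ≤ C m^{-r}}`;
the operator is defined for `m ≥ 2^d` only. -/
def betaPwConst {d : ℕ} (U : Set ((Fin d → ℝ) → ℝ)) : ℝ≥0∞ :=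
  convergenceOrder (2 ^ d) fun m => worstError (pwConst U m)

/-! ### Growth parameters -/

/-- `ℓ* = sup_{n ≥ 1} ℓ(n)`. -/
def maxDepth (ℓ : ℕ → ℕ∞) : ℕ∞ := ⨆ n : ℕ, ⨆ _ : 1 ≤ n, ℓ n

/-- `c(n) ≍ n^θ (ln (2n))^κ` on the positive integers. -/
def HasGrowth (c : ℕ → ℕ∞) (θ κ : ℝ) : Prop :=
  ∃ C₁ C₂ : ℝ, 0 < C₁ ∧ 0 < C₂ ∧ ∀ n : ℕ, 1 ≤ n →
    ENNReal.ofReal (C₁ * ((n : ℝ) ^ θ * Real.log (2 * n) ^ κ)) ≤ ((c n : ℕ∞) : ℝ≥0∞) ∧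
    ((c n : ℕ∞) : ℝ≥0∞) ≤ ENNReal.ofReal (C₂ * ((n : ℝ) ^ θ * Real.log (2 * n) ^ κ))

/-- `γ* = θ · L + ⌊L / 2⌋` for a finite maximal depth `L`. -/
def gammaStar (θ : ℝ) (L : ℕ) : ℝ := θ * L + ((L / 2 : ℕ) : ℝ)

/-- The number `(1/d) · α / (γ* + α)` if `ℓ* < ∞`, and `0` if `ℓ* = ∞`. -/
def optimalRate (d : ℕ) (α θ : ℝ) (ℓ : ℕ → ℕ∞) : ℝ≥0∞ :=
  open Classical in
  if maxDepth ℓ < ⊤ then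
    ENNReal.ofReal (1 / (d : ℝ) * (α / (gammaStar θ (maxDepth ℓ).toNat + α)))
  else 0

end NNApprox

end

namespace NNApprox

/-! ### Lipschitz bounds for networks -/

/-! The three orders satisfy `betaPwConst` ≤ `betaDet` ≤ `betaMC`, so a lower bound for the first
and a matching upper bound for the last suffice.

Lower bound. A layer of a network with at most `n` nonzero weights of size at most `c` costs a
factor `c` as a map from `ℓ¹` to `ℓ^∞`, and `c * n` as a map from `ℓ^∞` to `ℓ¹`. Alternating the two
norms through `L` layers gives the Lipschitz constant `c ^ L * n ^ ⌊L / 2⌋`, about `n ^ γ*`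
(`Network.lipschitz_bounds`). A function in the unit ball is within order `n ^ (-α)` of such a
network for every `n`, so its oscillation over distance `1 / N` is at most of order `n ^ (-α) + n ^
γ* / N`. Choosing `n ≈ N ^ (1 / (γ* + α))` with `N ≈ m ^ (1 / d)` yields the rate for piecewise
constant interpolation (`exists_worstError_pwConst_le`).

Upper bound. The Lipschitz estimate is sharp: layers of alternating widths `n` and `1` with all
weights maximal compute cones of slope `B = w ^ L * n ^ ⌊L / 2⌋`, where `w` is the weight bound,
with `N = O(n)` weights (`exists_network_bump`). Cones of height about `N ^ (-α)` belong to the unit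
ball, and about `(B * N ^ α) ^ d` of them fit disjointly into the cube. With at most half as many
samples, most signs cannot be detected, so even randomized algorithms err by order `N ^ (-α)`
(`ofReal_half_le_mcError`, `ofReal_le_mcError_unitBall`). Letting `N → ∞` bounds the order
(`order_mul_le`).

Logarithms in the growth of `c` are absorbed into exponents `± ε`, and `ε → 0` at the end. For
unbounded depth the upper bound holds with every finite `L`, and the rates tend to `0`. -/

theorem abs_entry_le_matrixMax {k l : ℕ} (A : Matrix (Fin k) (Fin l) ℝ) (i : Fin k)
    (j : Fin l) : |A i j| ≤ matrixMax A := by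
  have h : ‖A i j‖₊ ≤ matrixMax A :=
    Finset.le_sup (f := fun q : Fin k × Fin l => ‖A q.1 q.2‖₊) (Finset.mem_univ (i, j))
  exact_mod_cast h

theorem matrixMax_le {k l : ℕ} {A : Matrix (Fin k) (Fin l) ℝ} {c : ℝ≥0}
    (h : ∀ i j, |A i j| ≤ c) : matrixMax A ≤ c :=
  Finset.sup_le fun q _ => by exact_mod_cast h q.1 q.2

theorem vecMax_le {k : ℕ} {b : Fin k → ℝ} {c : ℝ≥0} (h : ∀ i, |b i| ≤ c) : vecMax b ≤ c :=
  Finset.sup_le fun q _ => by exact_mod_cast h q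

theorem matrixNnz_le {k l : ℕ} (A : Matrix (Fin k) (Fin l) ℝ) : matrixNnz A ≤ k * l := by
  refine (Finset.card_filter_le _ _).trans ?_
  simp

theorem vecNnz_le {k : ℕ} (b : Fin k → ℝ) : vecNnz b ≤ k := by
  refine (Finset.card_filter_le _ _).trans ?_
  simp

theorem sum_abs_entries_le {k l : ℕ} (A : Matrix (Fin k) (Fin l) ℝ) :
    ∑ i, ∑ j, |A i j| ≤ matrixNnz A * matrixMax A := by
  rw [← Fintype.sum_prod_type' (f := fun i j => |A i j|)]
  have h : ∑ q : Fin k × Fin l, |A q.1 q.2|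
      = ∑ q : Fin k × Fin l with A q.1 q.2 ≠ 0, |A q.1 q.2| := by
    rw [Finset.sum_filter]
    refine Finset.sum_congr rfl fun q _ => ?_
    by_cases hq : A q.1 q.2 = 0 <;> simp [hq]
  rw [h, matrixNnz, ← nsmul_eq_mul]
  exact Finset.sum_le_card_nsmul _ _ _ fun q _ => abs_entry_le_matrixMax A _ _

theorem affine_sub_apply {i h : ℕ} (A : Matrix (Fin h) (Fin i) ℝ) (b : Fin h → ℝ)
    (x y : Fin i → ℝ) (k : Fin h) :
    (A.mulVec x + b) k - (A.mulVec y + b) k = ∑ j, A k j * (x j - y j) := by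
  simp [Matrix.mulVec, dotProduct, mul_sub, Finset.sum_sub_distrib]

theorem abs_affine_sub_le_sum {i h : ℕ} (A : Matrix (Fin h) (Fin i) ℝ) (b : Fin h → ℝ)
    {c : ℝ} (hc : matrixMax A ≤ c) (x y : Fin i → ℝ) (k : Fin h) :
    |(A.mulVec x + b) k - (A.mulVec y + b) k| ≤ c * ∑ j, |x j - y j| := by
  rw [affine_sub_apply, Finset.mul_sum]
  refine (Finset.abs_sum_le_sum_abs _ _).trans (Finset.sum_le_sum fun j _ => ?_)
  rw [abs_mul]
  gcongr
  exact (abs_entry_le_matrixMax A k j).trans hc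

/-- Passing from `ℓ^∞` to `ℓ¹` costs the sum of all absolute entries, hence the number of nonzero
entries times the largest one. The opposite direction, `abs_affine_sub_le_sum`, costs only the
largest entry. -/
theorem sum_abs_affine_sub_le {i h : ℕ} (A : Matrix (Fin h) (Fin i) ℝ) (b : Fin h → ℝ)
    {c n D : ℝ} (hc : matrixMax A ≤ c) (hn : (matrixNnz A : ℝ) ≤ n) (hD : 0 ≤ D)
    (x y : Fin i → ℝ) (hxy : ∀ j, |x j - y j| ≤ D) :
    ∑ k, |(A.mulVec x + b) k - (A.mulVec y + b) k| ≤ c * n * D := by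
  have h1 : ∀ k, |(A.mulVec x + b) k - (A.mulVec y + b) k| ≤ (∑ j, |A k j|) * D := by
    intro k
    rw [affine_sub_apply, Finset.sum_mul]
    refine (Finset.abs_sum_le_sum_abs _ _).trans (Finset.sum_le_sum fun j _ => ?_)
    rw [abs_mul]
    gcongr
    exact hxy j
  refine (Finset.sum_le_sum fun k _ => h1 k).trans ?_
  rw [← Finset.sum_mul]
  gcongr
  refine (sum_abs_entries_le A).trans ?_
  rw [mul_comm]
  have : (0 : ℝ) ≤ matrixMax A := (matrixMax A).2
  have := this.trans hc
  gcongr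

theorem abs_relu_sub_relu_le (a b : ℝ) : |max 0 a - max 0 b| ≤ |a - b| := by
  simpa using abs_max_sub_max_le_max 0 a 0 b

/-- A network with `L` layers, at most `n` nonzero weights, and weights bounded by `c` has
Lipschitz constants `c ^ L * n ^ ⌊L / 2⌋` with respect to the `ℓ¹` norm, and
`c ^ L * n ^ ⌈L / 2⌉` with respect to the `ℓ^∞` norm. -/
theorem Network.lipschitz_bounds {i o : ℕ} (Φ : Network i o) {c n : ℝ}
    (hc : Φ.weightSize ≤ c) (hn : (Φ.numWeights : ℝ) ≤ n) (x y : Fin i → ℝ) :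
    (∀ k, |Φ.realize x k - Φ.realize y k|
      ≤ c ^ Φ.depth * n ^ (Φ.depth / 2) * ∑ j, |x j - y j|) ∧
    ∀ D : ℝ, 0 ≤ D → (∀ j, |x j - y j| ≤ D) → ∀ k, |Φ.realize x k - Φ.realize y k|
      ≤ c ^ Φ.depth * n ^ ((Φ.depth + 1) / 2) * D := by
  induction Φ with
  | last A b =>
    simp only [weightSize, numWeights, NNReal.coe_max, max_le_iff, Nat.cast_add] at hc hn
    have hn' : (matrixNnz A : ℝ) ≤ n := by
      have : (0 : ℝ) ≤ vecNnz b := by positivity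
      linarith
    constructor
    · intro k
      simpa only [depth, realize, pow_one, Nat.reduceDiv, pow_zero, mul_one] using
        abs_affine_sub_le_sum A b hc.1 x y k
    · intro D hD hxy k
      have h := sum_abs_affine_sub_le A b hc.1 hn' hD x y hxy
      simp only [depth, realize, pow_one, Nat.reduceAdd, Nat.reduceDiv]
      exact (Finset.single_le_sum (f := fun k => |(A.mulVec x + b) k - (A.mulVec y + b) k|)
        (fun _ _ => abs_nonneg _) (Finset.mem_univ k)).trans h
  | layer hh A b Φ ih =>
    simp only [weightSize, numWeights, NNReal.coe_max, max_le_iff, Nat.cast_add] at hc hn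
    have h0A : (0 : ℝ) ≤ matrixNnz A := by positivity
    have h0b : (0 : ℝ) ≤ vecNnz b := by positivity
    have h0Φ : (0 : ℝ) ≤ Φ.numWeights := by positivity
    have hc0 : 0 ≤ c := (matrixMax A).2.trans hc.1.1
    have hn0 : 0 ≤ n := by linarith
    have ih' := ih hc.2 (by linarith) (fun k => max 0 ((A.mulVec x + b) k))
      fun k => max 0 ((A.mulVec y + b) k)
    -- Each bound for the longer network uses the other bound for the tail: the first layer switches
    -- the norm, and only the switch from `ℓ^∞` to `ℓ¹` pays a factor `n`.
    constructor
    · intro k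
      have h := ih'.2 (c * ∑ j, |x j - y j|)
        (mul_nonneg hc0 (Finset.sum_nonneg fun _ _ => abs_nonneg _))
        (fun j => (abs_relu_sub_relu_le _ _).trans (abs_affine_sub_le_sum A b hc.1.1 x y j)) k
      simp only [depth, realize]
      refine h.trans_eq ?_
      ring
    · intro D hD hxy k
      have h := ih'.1 k
      simp only [depth, realize]
      refine h.trans ?_
      have h2 : ∑ k, |max 0 ((A.mulVec x + b) k) - max 0 ((A.mulVec y + b) k)| ≤ c * n * D :=
        (Finset.sum_le_sum fun k _ => abs_relu_sub_relu_le _ _).trans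
          (sum_abs_affine_sub_le A b hc.1.1 (by linarith) hD x y hxy)
      have h3 : (Φ.depth + 1 + 1) / 2 = Φ.depth / 2 + 1 := by omega
      rw [h3]
      calc _ ≤ c ^ Φ.depth * n ^ (Φ.depth / 2) * (c * n * D) := by gcongr
        _ = _ := by ring

/-! ### Essential suprema of continuous functions on the cube -/

/-- The continuous functions `|g|` and `min |g| a` agree almost everywhere, hence everywhere on the
cube. -/
theorem abs_le_of_ae_abs_le {d : ℕ} {g : (Fin d → ℝ) → ℝ} (hg : ContinuousOn g (cube d))
    {a : ℝ} (h : ∀ᵐ x ∂cubeMeasure d, |g x| ≤ a) {x : Fin d → ℝ} (hx : x ∈ cube d) :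
    |g x| ≤ a := by
  have h1 : (fun x => |g x|) =ᵐ[cubeMeasure d] fun x => min |g x| a := by
    filter_upwards [h] with x hx using (min_eq_left hx).symm
  have h2 := eqOn_of_ae_eq hg.abs (hg.abs.inf continuousOn_const) h1 hx
  exact min_eq_left_iff.1 h2.symm

theorem abs_le_of_eLpNorm_le {d : ℕ} {g : (Fin d → ℝ) → ℝ} (hg : ContinuousOn g (cube d))
    {a : ℝ} (ha : 0 ≤ a) (h : eLpNorm g ∞ (cubeMeasure d) ≤ ENNReal.ofReal a)
    {x : Fin d → ℝ} (hx : x ∈ cube d) : |g x| ≤ a := by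
  refine abs_le_of_ae_abs_le hg ?_ hx
  rw [eLpNorm_exponent_top] at h
  filter_upwards [ae_le_eLpNormEssSup (f := g) (μ := cubeMeasure d)] with y hy
  have h5 := hy.trans h
  rwa [← ofReal_norm, ENNReal.ofReal_le_ofReal_iff ha] at h5

theorem eLpNorm_le_of_abs_le {d : ℕ} {g : (Fin d → ℝ) → ℝ} {a : ℝ}
    (h : ∀ x ∈ cube d, |g x| ≤ a) :
    eLpNorm g ∞ (cubeMeasure d) ≤ ENNReal.ofReal a := by
  rw [eLpNorm_exponent_top]
  refine eLpNormEssSup_le_of_ae_bound ?_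
  filter_upwards [ae_restrict_mem (μ := volume)
    (measurableSet_Icc : MeasurableSet (cube d))] with x hx using h x hx

theorem memLp_of_continuousOn {d : ℕ} {g : (Fin d → ℝ) → ℝ} (hg : ContinuousOn g (cube d)) :
    MemLp g ∞ (cubeMeasure d) := by
  have hcpt : IsCompact (cube d) := isCompact_Icc
  obtain ⟨a, ha⟩ := hcpt.exists_bound_of_continuousOn hg
  exact ⟨hg.aestronglyMeasurable measurableSet_Icc,
    (eLpNorm_le_of_abs_le ha).trans_lt ENNReal.ofReal_lt_top⟩

/-! ### Growth of logarithms -/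

theorem exists_log_rpow_le (κ : ℝ) {ε : ℝ} (hε : 0 < ε) :
    ∃ C : ℝ, 0 < C ∧ ∀ n : ℕ, 1 ≤ n → Real.log (2 * n) ^ κ ≤ C * (n : ℝ) ^ ε := by
  have hlog2 : 0 < Real.log 2 := Real.log_pos (by norm_num)
  have hlog : ∀ n : ℕ, 1 ≤ n → Real.log 2 ≤ Real.log (2 * n) := by
    intro n hn
    have : (1 : ℝ) ≤ n := by exact_mod_cast hn
    exact Real.log_le_log (by norm_num) (by linarith)
  rcases le_or_gt κ 0 with hκ | hκ
  · refine ⟨Real.log 2 ^ κ, by positivity, fun n hn => ?_⟩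
    have hn1 : (1 : ℝ) ≤ n := by exact_mod_cast hn
    calc Real.log (2 * n) ^ κ ≤ Real.log 2 ^ κ :=
          Real.rpow_le_rpow_of_nonpos hlog2 (hlog n hn) hκ
      _ ≤ _ := le_mul_of_one_le_right (by positivity) (Real.one_le_rpow hn1 hε.le)
  · refine ⟨(2 ^ (ε / κ) / (ε / κ)) ^ κ, by positivity, fun n hn => ?_⟩
    -- The exponent `ε / κ` becomes `ε` after raising to the power `κ`.
    have h := Real.log_le_rpow_div (x := 2 * n) (by positivity) (div_pos hε hκ)
    calc Real.log (2 * n) ^ κ ≤ ((2 * n : ℝ) ^ (ε / κ) / (ε / κ)) ^ κ :=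
          Real.rpow_le_rpow (hlog2.le.trans (hlog n hn)) h hκ.le
      _ = (2 ^ (ε / κ) / (ε / κ) * (n : ℝ) ^ (ε / κ)) ^ κ := by
          rw [Real.mul_rpow (by norm_num) (by positivity)]
          ring_nf
      _ = _ := by
          rw [Real.mul_rpow (by positivity) (by positivity), ← Real.rpow_mul (by positivity),
            div_mul_cancel₀ _ hκ.ne']

/-- Under the growth assumption, `c` takes finite values between `C₁ n ^ (θ - ε)` and
`C₂ n ^ (θ + ε)`. -/
theorem HasGrowth.exists_bounds {c : ℕ → ℕ∞} {θ κ : ℝ} (h : HasGrowth c θ κ) {ε : ℝ}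
    (hε : 0 < ε) :
    ∃ C₁ C₂ : ℝ, 0 < C₁ ∧ 0 < C₂ ∧ ∀ n : ℕ, 1 ≤ n → ∃ w : ℕ, c n = w ∧
      C₁ * (n : ℝ) ^ (θ - ε) ≤ w ∧ (w : ℝ) ≤ C₂ * (n : ℝ) ^ (θ + ε) := by
  obtain ⟨C₁, C₂, hC₁, hC₂, hb⟩ := h
  -- An upper bound for the power `-κ` of the logarithm is a lower bound for its power `κ`.
  obtain ⟨D₁, hD₁, hlow⟩ := exists_log_rpow_le (-κ) hε
  obtain ⟨D₂, hD₂, hup⟩ := exists_log_rpow_le κ hε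
  refine ⟨C₁ / D₁, C₂ * D₂, by positivity, by positivity, fun n hn => ?_⟩
  have hn0 : (0 : ℝ) < n := by exact_mod_cast hn
  have hn1 : (1 : ℝ) ≤ n := by exact_mod_cast hn
  have hlog : 0 < Real.log (2 * n) := Real.log_pos (by linarith)
  obtain ⟨h1, h2⟩ := hb n hn
  have htop : c n ≠ ⊤ := by
    intro htop
    rw [htop] at h2
    simp at h2
  obtain ⟨w, hw⟩ := ENat.ne_top_iff_exists.1 htop
  rw [← hw] at h1 h2
  have h1' : C₁ * ((n : ℝ) ^ θ * Real.log (2 * n) ^ κ) ≤ w := by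
    have : ENNReal.ofReal (C₁ * ((n : ℝ) ^ θ * Real.log (2 * n) ^ κ))
        ≤ ENNReal.ofReal (w : ℝ) := by simpa using h1
    rwa [ENNReal.ofReal_le_ofReal_iff (by positivity)] at this
  have h2' : (w : ℝ) ≤ C₂ * ((n : ℝ) ^ θ * Real.log (2 * n) ^ κ) := by
    have : ENNReal.ofReal (w : ℝ)
        ≤ ENNReal.ofReal (C₂ * ((n : ℝ) ^ θ * Real.log (2 * n) ^ κ)) := by simpa using h2
    rwa [ENNReal.ofReal_le_ofReal_iff (by positivity)] at this
  refine ⟨w, hw.symm, le_trans ?_ h1', h2'.trans ?_⟩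
  · have h3 := hlow n hn
    rw [Real.rpow_neg hlog.le] at h3
    have h4 : 0 < Real.log (2 * n) ^ κ := Real.rpow_pos_of_pos hlog _
    have h5 : 1 ≤ D₁ * (n : ℝ) ^ ε * Real.log (2 * n) ^ κ := by
      rwa [inv_le_iff_one_le_mul₀ h4] at h3
    rw [Real.rpow_sub hn0]
    have h6 : 0 < (n : ℝ) ^ ε := Real.rpow_pos_of_pos hn0 _
    have h7 : 0 < (n : ℝ) ^ θ := Real.rpow_pos_of_pos hn0 _
    rw [div_mul_div_comm, div_le_iff₀ (by positivity)]
    calc C₁ * (n : ℝ) ^ θ = C₁ * (n : ℝ) ^ θ * 1 := by ring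
      _ ≤ C₁ * (n : ℝ) ^ θ * (D₁ * (n : ℝ) ^ ε * Real.log (2 * n) ^ κ) := by gcongr
      _ = _ := by ring
  · rw [Real.rpow_add hn0]
    calc _ ≤ C₂ * ((n : ℝ) ^ θ * (D₂ * (n : ℝ) ^ ε)) := by
          gcongr
          exact hup n hn
      _ = _ := by ring

/-! ### Moduli of continuity in the unit ball -/

theorem depth_le_of_maxDepth_eq {ℓ : ℕ → ℕ∞} {L : ℕ} (hL : maxDepth ℓ = L) {n : ℕ}
    (hn : 1 ≤ n) : ℓ n ≤ L :=
  (le_iSup₂ (f := fun (n : ℕ) (_ : 1 ≤ n) => ℓ n) n hn).trans hL.le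

theorem exists_lipschitz_networkFunctions (d : ℕ) {ℓ c : ℕ → ℕ∞} {L : ℕ}
    (hL : maxDepth ℓ = L) (hc : ∀ n : ℕ, 1 ≤ n → 1 ≤ c n) {θ κ : ℝ}
    (hc_growth : HasGrowth c θ κ) {ε : ℝ} (hε : 0 < ε) :
    ∃ C : ℝ, 0 < C ∧ ∀ n : ℕ, 1 ≤ n → ∀ g ∈ networkFunctions d ℓ c n, ∀ x y : Fin d → ℝ,
      |g x - g y| ≤ C * (n : ℝ) ^ (gammaStar θ L + ε) * ∑ j, |x j - y j| := by
  have hL0 : (0 : ℝ) < L + 1 := by positivity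
  -- The weight bound enters with power `L`, so its exponent may lose only `ε / (L + 1)`; the `+ 1`
  -- avoids dividing by zero.
  obtain ⟨C₁, C₂, hC₁, hC₂, hb⟩ := hc_growth.exists_bounds (div_pos hε hL0)
  refine ⟨C₂ ^ L, by positivity, ?_⟩
  rintro n hn g ⟨Φ, hW, hD, hS, rfl⟩ x y
  obtain ⟨w, hw, -, hw2⟩ := hb n hn
  have hn1 : (1 : ℝ) ≤ n := by exact_mod_cast hn
  have hn0 : (0 : ℝ) < n := by linarith
  -- A network may have fewer than `L` layers; a base of at least `1` allows its depth to be
  -- replaced by `L`.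
  have hw1 : (1 : ℝ) ≤ w := by
    have := hc n hn
    rw [hw] at this
    exact_mod_cast this
  have hS' : (Φ.weightSize : ℝ) ≤ w := by
    rw [hw] at hS
    have h : (Φ.weightSize : ℝ≥0∞) ≤ ((w : ℝ≥0) : ℝ≥0∞) := by simpa using hS
    exact_mod_cast h
  have hdep : Φ.depth ≤ L := by
    have h := hD.trans (depth_le_of_maxDepth_eq hL hn)
    exact_mod_cast h
  have h := (Φ.lipschitz_bounds hS' (n := n) (by exact_mod_cast hW) x y).1 0
  refine h.trans ?_
  have hsum : 0 ≤ ∑ j, |x j - y j| := Finset.sum_nonneg fun _ _ => abs_nonneg _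
  refine mul_le_mul_of_nonneg_right ?_ hsum
  have e1 : (w : ℝ) ^ Φ.depth ≤ w ^ L := pow_le_pow_right₀ hw1 hdep
  have e2 : (n : ℝ) ^ (Φ.depth / 2) ≤ (n : ℝ) ^ (L / 2) :=
    pow_le_pow_right₀ hn1 (Nat.div_le_div_right hdep)
  have e3 : (w : ℝ) ^ L ≤ C₂ ^ L * (n : ℝ) ^ ((θ + ε / (L + 1)) * L) := by
    rw [Real.rpow_mul_natCast hn0.le, ← mul_pow]
    exact pow_le_pow_left₀ (by positivity) hw2 L
  calc (w : ℝ) ^ Φ.depth * (n : ℝ) ^ (Φ.depth / 2)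
      ≤ (C₂ ^ L * (n : ℝ) ^ ((θ + ε / (L + 1)) * L)) * (n : ℝ) ^ (L / 2) := by
        have := e1.trans e3
        gcongr
    _ = C₂ ^ L * (n : ℝ) ^ ((θ + ε / (L + 1)) * L + ((L / 2 : ℕ) : ℝ)) := by
        rw [Real.rpow_add hn0, Real.rpow_natCast, mul_assoc]
    _ ≤ _ := by
        refine mul_le_mul_of_nonneg_left (Real.rpow_le_rpow_of_exponent_le hn1 ?_)
          (by positivity)
        rw [gammaStar]
        have : ε / (L + 1) * L ≤ ε := by
          rw [div_mul_eq_mul_div, div_le_iff₀ hL0]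
          nlinarith
        linarith

/-- The infimum defining the norm need not be attained, so the scaling `t` is only known to be below
a number larger than `1`; the choice `2` is arbitrary. -/
theorem exists_preNorm_le_one {d : ℕ} {α : ℝ} {ℓ c : ℕ → ℕ∞} {f : (Fin d → ℝ) → ℝ}
    (hf : f ∈ unitBall d α ℓ c) :
    ∃ t : ℝ, 0 < t ∧ t < 2 ∧ preNorm d α ∞ ℓ c (fun x => f x / t) ≤ 1 := by
  have h : approxNorm d α ∞ ℓ c f < ENNReal.ofReal 2 := hf.2.trans_lt (by norm_num)
  simp only [approxNorm, iInf_lt_iff] at h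
  obtain ⟨t, ⟨ht0, ht⟩, ht2⟩ := h
  exact ⟨t, ht0, (ENNReal.ofReal_lt_ofReal_iff (by norm_num)).1 ht2, ht⟩

theorem abs_le_two_of_mem_unitBall {d : ℕ} {α : ℝ} {ℓ c : ℕ → ℕ∞} {f : (Fin d → ℝ) → ℝ}
    (hf : f ∈ unitBall d α ℓ c) {x : Fin d → ℝ} (hx : x ∈ cube d) : |f x| ≤ 2 := by
  obtain ⟨t, ht0, ht2, ht⟩ := exists_preNorm_le_one hf
  have h := abs_le_of_eLpNorm_le (hf.1.div_const t) zero_le_one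
    (((le_max_left _ _).trans ht).trans_eq ENNReal.ofReal_one.symm) hx
  rw [abs_div, abs_of_pos ht0, div_le_one ht0] at h
  linarith

theorem natCast_rpow_eq_ofReal {n : ℕ} (hn : 1 ≤ n) (α : ℝ) :
    (n : ℝ≥0∞) ^ α = ENNReal.ofReal ((n : ℝ) ^ α) := by
  have hn0 : (0 : ℝ) < n := by exact_mod_cast hn
  rw [← ENNReal.ofReal_rpow_of_pos hn0, ENNReal.ofReal_natCast]

theorem exists_networkFunction_near {d : ℕ} {α : ℝ} {ℓ c : ℕ → ℕ∞} {f : (Fin d → ℝ) → ℝ}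
    (hf : f ∈ unitBall d α ℓ c) :
    ∃ t : ℝ, 0 < t ∧ t < 2 ∧ ∀ n : ℕ, 1 ≤ n → ∃ g ∈ networkFunctions d ℓ c n,
      ∀ x ∈ cube d, |f x / t - g x| ≤ 2 * (n : ℝ) ^ (-α) := by
  obtain ⟨t, ht0, ht2, ht⟩ := exists_preNorm_le_one hf
  refine ⟨t, ht0, ht2, fun n hn => ?_⟩
  have hn0 : (0 : ℝ) < n := by exact_mod_cast hn
  have h2 := (le_iSup₂ (f := fun (n : ℕ) (_ : 1 ≤ n) => (n : ℝ≥0∞) ^ α *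
      ⨅ g ∈ networkFunctions d ℓ c n,
        eLpNorm (fun x => f x / t - g x) ∞ (cubeMeasure d)) n hn).trans
    ((le_max_right _ _).trans ht)
  have h3 : (⨅ g ∈ networkFunctions d ℓ c n,
      eLpNorm (fun x => f x / t - g x) ∞ (cubeMeasure d)) <
        ENNReal.ofReal (2 * (n : ℝ) ^ (-α)) := by
    by_contra hcon
    rw [not_lt] at hcon
    have h4 := (mul_le_mul_right hcon ((n : ℝ≥0∞) ^ α)).trans h2
    rw [natCast_rpow_eq_ofReal hn, ← ENNReal.ofReal_mul (by positivity),
      Real.rpow_neg hn0.le] at h4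
    have hp : (0 : ℝ) < (n : ℝ) ^ α := Real.rpow_pos_of_pos hn0 α
    rw [show (n : ℝ) ^ α * (2 * ((n : ℝ) ^ α)⁻¹) = 2 by field_simp] at h4
    norm_num at h4
  simp only [iInf_lt_iff] at h3
  obtain ⟨g, hg, hgn⟩ := h3
  refine ⟨g, hg, fun x hx => ?_⟩
  obtain ⟨Φ, -, -, -, rfl⟩ := hg
  have hcont : Continuous fun x => Φ.realize x 0 :=
    (continuous_apply 0).comp Φ.continuous_realize
  exact abs_le_of_eLpNorm_le ((hf.1.div_const t).sub hcont.continuousOn) (by positivity)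
    hgn.le hx

/-- Triangle inequality through a network function near `f / t`: two approximation errors `2 * n ^
(-α)`, then a factor `t < 2`, give the constant `8`. The size `n` stays free, to be balanced against
the distance. -/
theorem exists_modulus_unitBall (d : ℕ) (α : ℝ) {ℓ c : ℕ → ℕ∞} {L : ℕ}
    (hL : maxDepth ℓ = L) (hc : ∀ n : ℕ, 1 ≤ n → 1 ≤ c n) {θ κ : ℝ}
    (hc_growth : HasGrowth c θ κ) {ε : ℝ} (hε : 0 < ε) :
    ∃ C : ℝ, 0 < C ∧ ∀ f ∈ unitBall d α ℓ c, ∀ n : ℕ, 1 ≤ n → ∀ x ∈ cube d, ∀ y ∈ cube d,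
      |f x - f y| ≤ 8 * (n : ℝ) ^ (-α)
        + C * (n : ℝ) ^ (gammaStar θ L + ε) * ∑ j, |x j - y j| := by
  obtain ⟨C, hC, hlip⟩ := exists_lipschitz_networkFunctions d hL hc hc_growth hε
  refine ⟨2 * C, by positivity, fun f hf n hn x hx y hy => ?_⟩
  obtain ⟨t, ht0, ht2, happ⟩ := exists_networkFunction_near hf
  obtain ⟨g, hg, hfg⟩ := happ n hn
  have hp : 0 ≤ (n : ℝ) ^ (-α) := by positivity
  have hq : 0 ≤ C * (n : ℝ) ^ (gammaStar θ L + ε) * ∑ j, |x j - y j| :=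
    mul_nonneg (by positivity) (Finset.sum_nonneg fun _ _ => abs_nonneg _)
  have h : |f x / t - f y / t| ≤ 4 * (n : ℝ) ^ (-α)
      + C * (n : ℝ) ^ (gammaStar θ L + ε) * ∑ j, |x j - y j| := by
    have h1 := abs_le.1 (hfg x hx)
    have h2 := abs_le.1 (hfg y hy)
    have h3 := abs_le.1 (hlip n hn g hg x y)
    rw [abs_le]
    constructor <;> linarith [h1.1, h1.2, h2.1, h2.2, h3.1, h3.2]
  rw [← sub_div, abs_div, abs_of_pos ht0, div_le_iff₀ ht0] at h
  refine h.trans ?_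
  nlinarith

/-! ### Piecewise constant interpolation -/

theorem two_le_floor_rpow {d m : ℕ} (hd : 1 ≤ d) (hm : 2 ^ d ≤ m) :
    2 ≤ ⌊(m : ℝ) ^ (1 / (d : ℝ))⌋₊ := by
  rw [Nat.le_floor_iff (by positivity), one_div]
  have h : ((2 : ℝ) ^ d) ^ ((d : ℝ)⁻¹) ≤ (m : ℝ) ^ ((d : ℝ)⁻¹) :=
    Real.rpow_le_rpow (by positivity) (by exact_mod_cast hm) (by positivity)
  rw [Real.pow_rpow_inv_natCast (by norm_num) (by omega)] at h
  exact_mod_cast h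

theorem gridSize_pos {d m : ℕ} (hd : 1 ≤ d) (hm : 2 ^ d ≤ m) : 1 ≤ gridSize d m := by
  have := two_le_floor_rpow hd hm
  rw [gridSize]
  omega

theorem card_grid_le {d m : ℕ} (hd : 1 ≤ d) (hm : 2 ^ d ≤ m) :
    (gridSize d m + 1) ^ d ≤ m := by
  have h2 := two_le_floor_rpow hd hm
  have h : gridSize d m + 1 = ⌊(m : ℝ) ^ (1 / (d : ℝ))⌋₊ := by
    rw [gridSize]
    omega
  rw [h]
  have h3 : ((⌊(m : ℝ) ^ (1 / (d : ℝ))⌋₊ : ℝ)) ^ d ≤ ((m : ℝ) ^ (1 / (d : ℝ))) ^ d :=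
    pow_le_pow_left₀ (by positivity) (Nat.floor_le (by positivity)) d
  rw [one_div] at h3 ⊢
  rw [Real.rpow_inv_natCast_pow (by positivity) (by omega)] at h3
  exact_mod_cast h3

/-- With `q = ⌊m ^ (1 / d)⌋ ≥ 2`, one has `m ^ (1 / d) < q + 1 ≤ 4 * (q - 1)`. -/
theorem rpow_le_four_mul_gridSize {d m : ℕ} (hd : 1 ≤ d) (hm : 2 ^ d ≤ m) :
    (m : ℝ) ^ (1 / (d : ℝ)) ≤ 4 * gridSize d m := by
  have h1 := gridSize_pos hd hm
  have h2 := two_le_floor_rpow hd hm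
  have h3 := Nat.lt_floor_add_one ((m : ℝ) ^ (1 / (d : ℝ)))
  have h : ⌊(m : ℝ) ^ (1 / (d : ℝ))⌋₊ + 1 ≤ 4 * gridSize d m := by
    rw [gridSize] at *
    omega
  have h' : (⌊(m : ℝ) ^ (1 / (d : ℝ))⌋₊ : ℝ) + 1 ≤ 4 * gridSize d m := by exact_mod_cast h
  linarith

theorem gridPoint_mem_cube {d n : ℕ} (hn : 1 ≤ n) (i : Fin d → Fin (n + 1)) :
    gridPoint n i ∈ cube d := by
  have hn0 : (0 : ℝ) < n := by exact_mod_cast hn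
  refine ⟨fun j => ?_, fun j => ?_⟩
  · simp only [gridPoint, Pi.zero_apply]
    positivity
  · simp only [gridPoint, Pi.one_apply]
    rw [div_le_one hn0]
    exact_mod_cast Nat.lt_succ_iff.1 (i j).2

theorem pwConst_mem_Alg {d : ℕ} (hd : 1 ≤ d) (U : Set ((Fin d → ℝ) → ℝ)) {m : ℕ}
    (hm : 2 ^ d ≤ m) : pwConst U m ∈ Alg U m := by
  set n := gridSize d m with hn
  have hcard : Fintype.card (Fin d → Fin (n + 1)) ≤ Fintype.card (Fin m) := by
    simpa using card_grid_le hd hm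
  -- The grid may have fewer than `m` points. Its indices are embedded into `Fin m`, and the surplus
  -- samples repeat grid points and are ignored by `Q`.
  obtain ⟨e⟩ := Function.Embedding.nonempty_of_card_le hcard
  have hinv := Function.leftInverse_invFun e.injective
  refine ⟨fun k => gridPoint n (Function.invFun e k),
    fun k => gridPoint_mem_cube (gridSize_pos hd hm) _, fun v => ?_, ?_⟩
  · have h : MemLp (fun x => ∑ i : Fin d → Fin (n + 1),
        (gridCell n i).indicator (fun _ => v (e i)) x) ∞ (cubeMeasure d) :=
      memLp_finsetSum _ fun i _ =>
        (memLp_const _).indicator (MeasurableSet.univ_pi fun _ => measurableSet_Ico)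
    exact h.toLp _
  · intro f
    simp only [pwConst, hinv _]
    rfl

theorem exists_gridCell_mem {d n : ℕ} (hn : 1 ≤ n) {x : Fin d → ℝ} (hx : x ∈ cube d) :
    ∃ i : Fin d → Fin (n + 1), ∀ i', x ∈ gridCell n i' ↔ i' = i := by
  have hn0 : (0 : ℝ) < n := by exact_mod_cast hn
  have hx0 : ∀ j, 0 ≤ x j := fun j => hx.1 j
  -- The cells are half-open, so the index is the floor; the value `n` occurs exactly when `x j =
  -- 1`, which is why the grid has `n + 1` indices per axis.
  refine ⟨fun j => ⟨⌊n * x j⌋₊, ?_⟩, fun i' => ?_⟩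
  · rw [Nat.lt_succ_iff]
    apply Nat.floor_le_of_le
    have : x j ≤ 1 := hx.2 j
    nlinarith
  · simp only [gridCell, gridPoint, Set.mem_pi, Set.mem_univ, true_implies, Set.mem_Ico,
      funext_iff, Fin.ext_iff]
    refine forall_congr' fun j => ?_
    have h0 : 0 ≤ n * x j := mul_nonneg hn0.le (hx0 j)
    rw [eq_comm, Nat.floor_eq_iff h0, ← add_div, div_le_iff₀ hn0, lt_div_iff₀ hn0,
      mul_comm (x j)]

theorem exists_pwConstFun_eq {d m : ℕ} (hn : 1 ≤ gridSize d m) {f : (Fin d → ℝ) → ℝ}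
    {x : Fin d → ℝ} (hx : x ∈ cube d) :
    ∃ y ∈ cube d, pwConstFun d m f x = f y ∧ ∑ j, |y j - x j| ≤ d / (gridSize d m : ℝ) := by
  obtain ⟨i, hi⟩ := exists_gridCell_mem hn hx
  refine ⟨gridPoint (gridSize d m) i, gridPoint_mem_cube hn i, ?_, ?_⟩
  · rw [pwConstFun, Finset.sum_eq_single i]
    · exact Set.indicator_of_mem ((hi i).2 rfl) _
    · intro i' _ hne
      exact Set.indicator_of_notMem (fun h => hne ((hi i').1 h)) _
    · simp
  · have h := (hi i).2 rfl
    have h1 : ∀ j ∈ (Finset.univ : Finset (Fin d)),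
        |gridPoint (gridSize d m) i j - x j| ≤ 1 / (gridSize d m : ℝ) := by
      intro j _
      have hj := h j trivial
      rw [abs_le]
      constructor <;> linarith [hj.1, hj.2, show (0 : ℝ) ≤ 1 / (gridSize d m : ℝ) by positivity]
    refine (Finset.sum_le_sum h1).trans_eq ?_
    simp [div_eq_mul_inv]

theorem errorAt_pwConst {d : ℕ} (U : Set ((Fin d → ℝ) → ℝ)) (m : ℕ) (f : U) :
    errorAt (pwConst U m f) f.1
      = eLpNorm (fun x => pwConstFun d m f.1 x - f.1 x) ∞ (cubeMeasure d) := by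
  refine eLpNorm_congr_ae ?_
  filter_upwards [(memLp_pwConstFun d m f.1).coeFn_toLp] with x hx
  simp only [pwConst, hx]

theorem exists_worstError_pwConst_le (d : ℕ) (hd : 1 ≤ d) {α : ℝ} (hα : 0 < α)
    {ℓ c : ℕ → ℕ∞} {L : ℕ} (hL : maxDepth ℓ = L) (hc : ∀ n : ℕ, 1 ≤ n → 1 ≤ c n) {θ κ : ℝ}
    (hθ : 0 ≤ θ) (hc_growth : HasGrowth c θ κ) {ε : ℝ} (hε : 0 < ε) :
    ∃ C : ℝ, 0 < C ∧ ∀ m : ℕ, 2 ^ d ≤ m →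
      worstError (pwConst (unitBall d α ℓ c) m)
        ≤ ENNReal.ofReal (C * (m : ℝ) ^ (-(1 / d * (α / (gammaStar θ L + ε + α))))) := by
  obtain ⟨C, hC, hmod⟩ := exists_modulus_unitBall d α hL hc hc_growth hε
  have hγ0 : 0 ≤ gammaStar θ L := by
    rw [gammaStar]
    positivity
  set γ := gammaStar θ L + ε with hγ
  have hγp : 0 < γ := by positivity
  set ρ := α / (γ + α) with hρ
  have hρ0 : 0 < ρ := by positivity
  refine ⟨(8 + C * 2 ^ γ * d) * 4 ^ ρ, by positivity, fun m hm => ?_⟩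
  have hN := gridSize_pos hd hm
  set N := gridSize d m with hNdef
  have hN1 : (1 : ℝ) ≤ N := by exact_mod_cast hN
  have hN0 : (0 : ℝ) < N := by linarith
  -- the network size that balances approximation error and modulus of continuity
  obtain ⟨n, hn, hlow, hup⟩ : ∃ n : ℕ, 1 ≤ n ∧ (N : ℝ) ^ (1 / (γ + α)) ≤ n ∧
      (n : ℝ) ≤ 2 * (N : ℝ) ^ (1 / (γ + α)) := by
    have h1 : 1 ≤ (N : ℝ) ^ (1 / (γ + α)) := Real.one_le_rpow hN1 (by positivity)
    have h2 := Nat.le_ceil ((N : ℝ) ^ (1 / (γ + α)))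
    have h3 := Nat.ceil_lt_add_one (show 0 ≤ (N : ℝ) ^ (1 / (γ + α)) by positivity)
    refine ⟨⌈(N : ℝ) ^ (1 / (γ + α))⌉₊, ?_, h2, by linarith⟩
    exact_mod_cast h1.trans h2
  -- Both `n ^ (-α)` and `n ^ γ / N` are of order `N ^ (-ρ)`; the factor `2 ^ γ` pays for rounding
  -- `n` up to an integer.
  have hmain : 8 * (n : ℝ) ^ (-α) + C * (n : ℝ) ^ γ * (d / N)
      ≤ (8 + C * 2 ^ γ * d) * (N : ℝ) ^ (-ρ) := by
    have e1 : (n : ℝ) ^ (-α) ≤ (N : ℝ) ^ (-ρ) := by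
      calc (n : ℝ) ^ (-α) ≤ ((N : ℝ) ^ (1 / (γ + α))) ^ (-α) :=
            Real.rpow_le_rpow_of_nonpos (by positivity) hlow (by linarith)
        _ = _ := by
            rw [← Real.rpow_mul hN0.le]
            congr 1
            rw [hρ]
            ring
    have e2 : (n : ℝ) ^ γ ≤ 2 ^ γ * (N : ℝ) ^ (1 / (γ + α) * γ) := by
      calc (n : ℝ) ^ γ ≤ (2 * (N : ℝ) ^ (1 / (γ + α))) ^ γ :=
            Real.rpow_le_rpow (by positivity) hup hγp.le
        _ = _ := by rw [Real.mul_rpow (by norm_num) (by positivity), ← Real.rpow_mul hN0.le]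
    have e3 : (N : ℝ) ^ (1 / (γ + α) * γ) * (1 / N) = (N : ℝ) ^ (-ρ) := by
      rw [one_div (N : ℝ), ← Real.rpow_neg_one (N : ℝ), ← Real.rpow_add hN0]
      congr 1
      rw [hρ]
      field_simp
      ring
    calc 8 * (n : ℝ) ^ (-α) + C * (n : ℝ) ^ γ * (d / N)
        ≤ 8 * (N : ℝ) ^ (-ρ) + C * (2 ^ γ * (N : ℝ) ^ (1 / (γ + α) * γ)) * (d / N) := by
          gcongr
      _ = 8 * (N : ℝ) ^ (-ρ)
          + C * 2 ^ γ * d * ((N : ℝ) ^ (1 / (γ + α) * γ) * (1 / N)) := by ring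
      _ = _ := by
          rw [e3]
          ring
  have hm0 : (0 : ℝ) < m := by
    have : 0 < m := lt_of_lt_of_le (by positivity) hm
    exact_mod_cast this
  have hNm : (N : ℝ) ^ (-ρ) ≤ 4 ^ ρ * (m : ℝ) ^ (-(1 / d * ρ)) := by
    have h1 := rpow_le_four_mul_gridSize hd hm
    calc (N : ℝ) ^ (-ρ) ≤ ((m : ℝ) ^ (1 / (d : ℝ)) / 4) ^ (-ρ) := by
          refine Real.rpow_le_rpow_of_nonpos (by positivity) ?_ (by linarith)
          rw [div_le_iff₀ (by norm_num)]
          linarith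
      _ = _ := by
          rw [Real.div_rpow (by positivity) (by norm_num), ← Real.rpow_mul hm0.le,
            Real.rpow_neg (x := (4 : ℝ)) (by norm_num), div_inv_eq_mul, mul_comm]
          congr 2
          ring
  refine iSup_le fun f => ?_
  rw [errorAt_pwConst]
  refine eLpNorm_le_of_abs_le fun x hx => ?_
  obtain ⟨y, hy, hfy, hsum⟩ := exists_pwConstFun_eq hN (f := f.1) hx
  rw [hfy]
  calc |f.1 y - f.1 x| ≤ 8 * (n : ℝ) ^ (-α) + C * (n : ℝ) ^ γ * ∑ j, |y j - x j| :=
        hmod f.1 f.2 n hn y hy x hx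
    _ ≤ 8 * (n : ℝ) ^ (-α) + C * (n : ℝ) ^ γ * (d / N) := by gcongr
    _ ≤ (8 + C * 2 ^ γ * d) * (4 ^ ρ * (m : ℝ) ^ (-(1 / d * ρ))) :=
        hmain.trans (by gcongr)
    _ = _ := by ring

/-! ### Comparison of the convergence orders -/

theorem le_convergenceOrder {m₀ : ℕ} {e : ℕ → ℝ≥0∞} {r : ℝ≥0} {C : ℝ} (hC : 0 < C)
    (h : ∀ m : ℕ, m₀ ≤ m → e m ≤ ENNReal.ofReal (C * (m : ℝ) ^ (-(r : ℝ)))) :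
    (r : ℝ≥0∞) ≤ convergenceOrder m₀ e :=
  le_iSup₂ (f := fun (r : ℝ≥0) (_ : ∃ C : ℝ, 0 < C ∧
    ∀ m : ℕ, m₀ ≤ m → e m ≤ ENNReal.ofReal (C * (m : ℝ) ^ (-(r : ℝ)))) => (r : ℝ≥0∞))
    r ⟨C, hC, h⟩

theorem detError_unitBall_le_two (d : ℕ) (α : ℝ) (ℓ c : ℕ → ℕ∞) (m : ℕ) :
    detError (unitBall d α ℓ c) m ≤ ENNReal.ofReal 2 := by
  refine (iInf₂_le (fun _ => 0) ⟨fun _ => 0, fun _ => ⟨le_rfl, fun _ => zero_le_one⟩,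
    fun _ => 0, fun _ => rfl⟩).trans ?_
  refine iSup_le fun f => ?_
  have h : errorAt (0 : LInfty d) f.1 = eLpNorm (fun x => - f.1 x) ∞ (cubeMeasure d) := by
    refine eLpNorm_congr_ae ?_
    filter_upwards [Lp.coeFn_zero ℝ ∞ (cubeMeasure d)] with x hx
    rw [hx]
    simp
  rw [h]
  refine eLpNorm_le_of_abs_le fun x hx => ?_
  rw [abs_neg]
  exact abs_le_two_of_mem_unitBall f.2 hx

/-- Interpolation is controlled only for `m ≥ 2 ^ d`. For smaller `m` the zero algorithm has error
at most `2`, which the constant `2 * (2 ^ d) ^ r` absorbs. -/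
theorem betaPwConst_le_betaDet {d : ℕ} (hd : 1 ≤ d) (α : ℝ) (ℓ c : ℕ → ℕ∞) :
    betaPwConst (unitBall d α ℓ c) ≤ betaDet (unitBall d α ℓ c) := by
  refine iSup₂_le fun r ⟨C, hC, h⟩ => ?_
  refine le_convergenceOrder (C := max C (2 * ((2 : ℝ) ^ d) ^ (r : ℝ)))
    (hC.trans_le (le_max_left _ _)) fun m hm => ?_
  have hm0 : (0 : ℝ) < m := by exact_mod_cast hm
  rcases le_or_gt (2 ^ d) m with h2 | h2
  · refine ((iInf₂_le _ (pwConst_mem_Alg hd _ h2)).trans (h m h2)).trans ?_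
    gcongr
    exact le_max_left _ _
  · refine (detError_unitBall_le_two d α ℓ c m).trans (ENNReal.ofReal_le_ofReal ?_)
    have h3 : (m : ℝ) ^ (r : ℝ) ≤ ((2 : ℝ) ^ d) ^ (r : ℝ) :=
      Real.rpow_le_rpow hm0.le (by exact_mod_cast h2.le) r.2
    have h4 : 0 < (m : ℝ) ^ (r : ℝ) := by positivity
    rw [Real.rpow_neg hm0.le, ← div_eq_mul_inv, le_div_iff₀ h4]
    exact le_trans (by gcongr) (le_max_right _ _)

theorem mcError_le_detError {d : ℕ} (U : Set ((Fin d → ℝ) → ℝ)) {m : ℕ} (hm : 1 ≤ m) :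
    mcError.{u} U m ≤ detError U m := by
  refine le_iInf₂ fun A hA => ?_
  let R : RandomizedAlg.{u} U m :=
    { Ω := PUnit
      measurableSpace := ⊤
      P := Measure.dirac PUnit.unit
      isProbabilityMeasure := inferInstance
      A := fun _ => A
      numSamples := fun _ => m
      measurable_A := fun f => @measurable_const _ _ (borel (LInfty d)) _ _
      measurable_numSamples := measurable_const
      numSamples_pos := fun _ => hm
      mem_alg := fun _ => hA
      expectation_le := by simp }
  refine (iInf_le _ R).trans (iSup_mono fun f => ?_)
  simp [R]

theorem betaDet_le_betaMC {d : ℕ} (U : Set ((Fin d → ℝ) → ℝ)) :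
    betaDet U ≤ betaMC.{u} U :=
  iSup₂_le fun _ ⟨_, hC, h⟩ =>
    le_convergenceOrder hC fun m hm => (mcError_le_detError U hm).trans (h m hm)

/-- The order dominates the rate with loss `ε` for every `ε > 0`; the rate is continuous in `ε`, so
the limit `ε → 0` removes the loss. -/
theorem ofReal_le_betaPwConst (d : ℕ) (hd : 1 ≤ d) {α : ℝ} (hα : 0 < α)
    {ℓ c : ℕ → ℕ∞} {L : ℕ} (hL : maxDepth ℓ = L) (hc : ∀ n : ℕ, 1 ≤ n → 1 ≤ c n) {θ κ : ℝ}
    (hθ : 0 ≤ θ) (hc_growth : HasGrowth c θ κ) :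
    ENNReal.ofReal (1 / (d : ℝ) * (α / (gammaStar θ L + α)))
      ≤ betaPwConst (unitBall d α ℓ c) := by
  have hγ0 : 0 ≤ gammaStar θ L := by
    rw [gammaStar]
    positivity
  have hcont : Filter.Tendsto
      (fun ε : ℝ => ENNReal.ofReal (1 / (d : ℝ) * (α / (gammaStar θ L + ε + α))))
      (nhdsWithin 0 (Set.Ioi 0))
      (nhds (ENNReal.ofReal (1 / (d : ℝ) * (α / (gammaStar θ L + 0 + α))))) := by
    refine ENNReal.tendsto_ofReal (Filter.Tendsto.mono_left ?_ nhdsWithin_le_nhds)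
    have : ContinuousAt (fun ε : ℝ => 1 / (d : ℝ) * (α / (gammaStar θ L + ε + α))) 0 := by
      have : gammaStar θ L + 0 + α ≠ 0 := by positivity
      fun_prop (disch := assumption)
    exact this
  rw [add_zero] at hcont
  refine le_of_tendsto hcont ?_
  filter_upwards [self_mem_nhdsWithin] with ε hε
  have hε0 : (0 : ℝ) < ε := hε
  obtain ⟨C, hC, h⟩ := exists_worstError_pwConst_le d hd hα hL hc hθ hc_growth hε0
  have hr : 0 ≤ 1 / (d : ℝ) * (α / (gammaStar θ L + ε + α)) := by positivity
  refine le_convergenceOrder hC fun m hm => ?_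
  rw [Real.coe_toNNReal _ hr]
  exact h m hm

/-! ### Bump functions computed by networks -/

theorem networkFunctions_mono (d : ℕ) {ℓ c : ℕ → ℕ∞} (hℓ : MonotoneOn ℓ (Set.Ici 1))
    (hc : MonotoneOn c (Set.Ici 1)) {n k : ℕ} (hn : 1 ≤ n) (hnk : n ≤ k) :
    networkFunctions d ℓ c n ⊆ networkFunctions d ℓ c k := by
  rintro g ⟨Φ, hW, hD, hS, rfl⟩
  have hk : 1 ≤ k := hn.trans hnk
  refine ⟨Φ, hW.trans hnk, hD.trans (hℓ hn hk hnk), hS.trans ?_, rfl⟩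
  exact_mod_cast hc hn hk hnk

theorem zero_mem_networkFunctions (d : ℕ) {ℓ : ℕ → ℕ∞} (c : ℕ → ℕ∞) {n : ℕ} (hℓ : 1 ≤ ℓ n) :
    (fun _ => 0) ∈ networkFunctions d ℓ c n := by
  refine ⟨Network.last 0 0, ?_, by simpa [Network.depth] using hℓ, ?_, ?_⟩
  · simp [Network.numWeights, matrixNnz, vecNnz]
  · have h1 : matrixMax (0 : Matrix (Fin 1) (Fin d) ℝ) = 0 :=
      le_antisymm (matrixMax_le (by simp)) zero_le
    have h2 : vecMax (0 : Fin 1 → ℝ) = 0 := le_antisymm (vecMax_le (by simp)) zero_le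
    simp [Network.weightSize, h1, h2]
  · funext x
    simp [Network.realize]

namespace Network

/-- A network with `j + 1` layers of alternating widths `n` and `1` can multiply nonnegative
numbers by `± w ^ (j + 1) * n ^ ⌊(j + 1) / 2⌋`. -/
theorem exists_scaling {n : ℕ} (hn : 1 ≤ n) (w : ℝ≥0) {σ : ℝ} (hσ : |σ| ≤ 1) (j : ℕ) :
    ∃ Φ : Network 1 1, Φ.depth = j + 1 ∧ Φ.numWeights ≤ 2 * n * (j + 1) ∧
      Φ.weightSize ≤ w ∧ ∀ z : Fin 1 → ℝ, 0 ≤ z 0 →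
        Φ.realize z 0 = σ * (w ^ (j + 1) * (n : ℝ) ^ ((j + 1) / 2)) * z 0 := by
  have hσw : |σ * w| ≤ w := by
    rw [abs_mul, NNReal.abs_eq]
    exact mul_le_of_le_one_left w.2 hσ
  -- Fanning out to `n` neurons and summing back takes two layers and multiplies by `w ^ 2 * n`. The
  -- sign `σ` sits in the last layer, where no activation follows; before it all values are
  -- nonnegative and the activation is inactive.
  induction j using Nat.twoStepInduction with
  | zero =>
    refine ⟨last (fun _ _ => σ * w) 0, rfl, ?_, ?_, fun z hz => ?_⟩
    · have h1 := matrixNnz_le (fun (_ : Fin 1) (_ : Fin 1) => σ * (w : ℝ))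
      have h2 := vecNnz_le (0 : Fin 1 → ℝ)
      simp only [numWeights]
      omega
    · exact max_le (matrixMax_le fun _ _ => hσw) (vecMax_le (by simp))
    · simp [realize, Matrix.mulVec, dotProduct]
  | one =>
    refine ⟨layer (h := n) hn (fun _ _ => w) 0 (last (fun _ _ => σ * w) 0), rfl,
      ?_, ?_, fun z hz => ?_⟩
    · have h1 := matrixNnz_le (fun (_ : Fin n) (_ : Fin 1) => (w : ℝ))
      have h2 := vecNnz_le (0 : Fin n → ℝ)
      have h3 := matrixNnz_le (fun (_ : Fin 1) (_ : Fin n) => σ * (w : ℝ))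
      have h4 := vecNnz_le (0 : Fin 1 → ℝ)
      simp only [numWeights]
      omega
    · exact max_le (max_le (matrixMax_le fun _ _ => by simp) (vecMax_le (by simp)))
        (max_le (matrixMax_le fun _ _ => hσw) (vecMax_le (by simp)))
    · have h : 0 ≤ (w : ℝ) * z 0 := mul_nonneg w.2 hz
      simp [realize, Matrix.mulVec, dotProduct, max_eq_right h]
      ring
  | more j ih _ =>
    obtain ⟨Φ, hd, hW, hS, hR⟩ := ih
    refine ⟨layer (h := n) hn (fun _ _ => w) 0 (layer one_pos (fun _ _ => w) 0 Φ), ?_,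
      ?_, ?_, fun z hz => ?_⟩
    · simp [depth, hd]
    · have h1 := matrixNnz_le (fun (_ : Fin n) (_ : Fin 1) => (w : ℝ))
      have h2 := vecNnz_le (0 : Fin n → ℝ)
      have h3 := matrixNnz_le (fun (_ : Fin 1) (_ : Fin n) => (w : ℝ))
      have h4 := vecNnz_le (0 : Fin 1 → ℝ)
      simp only [numWeights]
      nlinarith
    · exact max_le (max_le (matrixMax_le fun _ _ => by simp) (vecMax_le (by simp)))
        (max_le (max_le (matrixMax_le fun _ _ => by simp) (vecMax_le (by simp))) hS)
    · have h : 0 ≤ (w : ℝ) * z 0 := mul_nonneg w.2 hz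
      simp only [realize]
      rw [hR _ (le_max_left _ _)]
      have h2 : 0 ≤ (w : ℝ) * (n * (w * z 0)) := by positivity
      have h3 : (j + 2 + 1) / 2 = (j + 1) / 2 + 1 := by omega
      simp [Matrix.mulVec, dotProduct, max_eq_right h, h3]
      rw [max_eq_right (by linarith)]
      ring

end Network

theorem max_zero_add_max_zero_neg (a : ℝ) : max 0 a + max 0 (-a) = |a| := by
  rcases le_total 0 a with h | h
  · rw [max_eq_right h, max_eq_left (by linarith), abs_of_nonneg h, add_zero]
  · rw [max_eq_left h, max_eq_right (by linarith), abs_of_nonpos h, zero_add]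

/-- The cone of slope `B` over the `ℓ¹` ball with center `y` and radius `r`. -/
noncomputable def bump {d : ℕ} (B r : ℝ) (y : Fin d → ℝ) : (Fin d → ℝ) → ℝ :=
  fun x => B * max 0 (r - ∑ j, |x j - y j|)

theorem continuous_bump {d : ℕ} (B r : ℝ) (y : Fin d → ℝ) : Continuous (bump B r y) := by
  unfold bump
  fun_prop

theorem bump_self {d : ℕ} (B : ℝ) {r : ℝ} (hr : 0 ≤ r) (y : Fin d → ℝ) :
    bump B r y y = B * r := by
  simp [bump, hr]

theorem bump_eq_zero {d : ℕ} (B : ℝ) {r : ℝ} {x y : Fin d → ℝ} {j : Fin d}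
    (h : r ≤ |x j - y j|) : bump B r y x = 0 := by
  have h1 : |x j - y j| ≤ ∑ j, |x j - y j| :=
    Finset.single_le_sum (f := fun j => |x j - y j|) (fun _ _ => abs_nonneg _)
      (Finset.mem_univ j)
  rw [bump, max_eq_left (by linarith), mul_zero]

theorem abs_bump_le {d : ℕ} {B r : ℝ} (hr : 0 ≤ r) (x y : Fin d → ℝ) :
    |bump B r y x| ≤ |B| * r := by
  rw [bump, abs_mul, abs_of_nonneg (le_max_left (0 : ℝ) _)]
  gcongr
  have : 0 ≤ ∑ j, |x j - y j| := Finset.sum_nonneg fun _ _ => abs_nonneg _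
  exact max_le hr (by linarith)

/-- Bump functions of slope `w ^ L * n ^ ⌊L / 2⌋` are computed by networks with `L` layers,
`O(n)` nonzero weights, and weights bounded by `w`. -/
theorem exists_network_bump {d : ℕ} (hd : 1 ≤ d) {n : ℕ} (hn : 1 ≤ n) (w : ℝ≥0) {σ : ℝ}
    (hσ : |σ| ≤ 1) (j : ℕ) {y : Fin d → ℝ} (hy : y ∈ cube d) {r : ℝ} (hr : 0 ≤ r)
    (hwr : w ^ 2 * n * r ≤ w) :
    ∃ Φ : Network d 1, Φ.depth = j + 3 ∧
      Φ.numWeights ≤ (2 * d * d + 4 * d + 2 * j + 3) * n ∧ Φ.weightSize ≤ w ∧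
      ∀ x, Φ.realize x 0 = bump (σ * (w ^ (j + 3) * (n : ℝ) ^ ((j + 3) / 2))) r y x := by
  obtain ⟨Φ, hdep, hW, hS, hR⟩ := Network.exists_scaling hn w hσ j
  -- The first layer has `n` copies of `w * (x i - y i)` and of its negative; after activation they
  -- sum to `w * n * ∑ i, |x i - y i|`.
  set ι := Fin d × Bool × Fin n
  have hcard : Fintype.card ι = d * (2 * n) := by simp [ι]
  have hpos : 0 < Fintype.card ι := by
    rw [hcard]
    positivity
  set e := Fintype.equivFin ι
  set s : ι → ℝ := fun q => if q.2.1 then (w : ℝ) else -w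
  have hs : ∀ q, |s q| = w := by
    intro q
    simp only [s]
    split_ifs <;> simp
  set A : Matrix (Fin (Fintype.card ι)) (Fin d) ℝ := fun k i =>
    if (e.symm k).1 = i then s (e.symm k) else 0 with hA
  set b : Fin (Fintype.card ι) → ℝ := fun k => -(s (e.symm k) * y (e.symm k).1) with hb
  set A' : Matrix (Fin 1) (Fin (Fintype.card ι)) ℝ := fun _ _ => -w with hA'
  -- The second layer subtracts `w` times that sum from this bias and truncates at zero, giving a
  -- cone of slope `w ^ 2 * n`. The hypothesis `hwr` says that the bias is an admissible weight.
  set b' : Fin 1 → ℝ := fun _ => w ^ 2 * n * r with hb'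
  refine ⟨.layer hpos A b (.layer one_pos A' b' Φ), ?_, ?_, ?_, fun x => ?_⟩
  · simp [Network.depth, hdep]
  · have h1 := (matrixNnz_le A).trans_eq (by rw [hcard])
    have h2 := (vecNnz_le b).trans_eq hcard
    have h3 := (matrixNnz_le A').trans_eq (by rw [hcard])
    have h4 := vecNnz_le b'
    simp only [Network.numWeights]
    nlinarith
  · refine max_le (max_le (matrixMax_le fun k i => ?_) (vecMax_le fun k => ?_))
      (max_le (max_le (matrixMax_le fun _ _ => ?_) (vecMax_le fun _ => ?_)) hS)
    · simp only [hA]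
      split_ifs
      · exact (hs _).le
      · simp
    · simp only [hb, abs_neg, abs_mul, hs]
      refine mul_le_of_le_one_right w.2 ?_
      rw [abs_of_nonneg (hy.1 _)]
      exact hy.2 _
    · simp [hA']
    · simp only [hb']
      rwa [abs_of_nonneg (by positivity)]
  · have h1 : ∀ k, (A.mulVec x + b) k = s (e.symm k) * (x (e.symm k).1 - y (e.symm k).1) := by
      intro k
      simp [Matrix.mulVec, dotProduct, hA, hb]
      ring
    have h2 : ∑ k, max 0 ((A.mulVec x + b) k) = w * n * ∑ i, |x i - y i| := by
      simp only [h1]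
      rw [Equiv.sum_comp e.symm (fun q : ι => max 0 (s q * (x q.1 - y q.1)))]
      simp only [ι, Fintype.sum_prod_type, Finset.mul_sum]
      refine Finset.sum_congr rfl fun i _ => ?_
      simp only [s, Finset.sum_const, Finset.card_univ, Fintype.card_fin, Fintype.sum_bool,
        nsmul_eq_mul, if_true, Bool.false_eq_true, if_false]
      rw [← mul_add, neg_mul, max_zero_add_max_zero_neg, abs_mul, NNReal.abs_eq]
      ring
    simp only [Network.realize]
    rw [hR _ (le_max_left _ _)]
    have h3 : (A'.mulVec (fun k => max 0 ((A.mulVec x + b) k)) + b') 0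
        = w ^ 2 * n * (r - ∑ i, |x i - y i|) := by
      have : (A'.mulVec (fun k => max 0 ((A.mulVec x + b) k)) + b') 0
          = -w * ∑ k, max 0 ((A.mulVec x + b) k) + w ^ 2 * n * r := by
        rw [Finset.mul_sum]
        simp only [Matrix.mulVec, dotProduct, hA', hb', Pi.add_apply]
      rw [this, h2]
      ring
    have h4 : max 0 (w ^ 2 * n * (r - ∑ i, |x i - y i|))
        = w ^ 2 * n * max 0 (r - ∑ i, |x i - y i|) := by
      rw [mul_max_of_nonneg _ _ (by positivity), mul_zero]
    have h5 : (j + 3) / 2 = (j + 1) / 2 + 1 := by omega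
    rw [h3, h4, bump, h5]
    ring

/-- A function of `Σ_N` that is bounded by `N ^ (-α)` belongs to the unit ball. -/
theorem mem_unitBall_of_mem_networkFunctions {d : ℕ} {α : ℝ} (hα : 0 < α) {ℓ c : ℕ → ℕ∞}
    (hℓ_mono : MonotoneOn ℓ (Set.Ici 1)) (hℓ : ∀ n : ℕ, 1 ≤ n → 2 ≤ ℓ n)
    (hc_mono : MonotoneOn c (Set.Ici 1)) {N : ℕ} (hN : 1 ≤ N) {f : (Fin d → ℝ) → ℝ}
    (hf : f ∈ networkFunctions d ℓ c N) (hbound : ∀ x ∈ cube d, |f x| ≤ (N : ℝ) ^ (-α)) :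
    f ∈ unitBall d α ℓ c := by
  have hcont : Continuous f := by
    obtain ⟨Φ, -, -, -, rfl⟩ := hf
    exact (continuous_apply 0).comp Φ.continuous_realize
  have hN1 : (1 : ℝ) ≤ N := by exact_mod_cast hN
  have hnorm : eLpNorm f ∞ (cubeMeasure d) ≤ ENNReal.ofReal ((N : ℝ) ^ (-α)) :=
    eLpNorm_le_of_abs_le hbound
  refine ⟨hcont.continuousOn, ?_⟩
  have hpre : preNorm d α ∞ ℓ c (fun x => f x / 1) ≤ 1 := by
    simp only [div_one]
    refine max_le (hnorm.trans ?_) (iSup₂_le fun k hk => ?_)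
    · rw [ENNReal.ofReal_le_one]
      exact Real.rpow_le_one_of_one_le_of_nonpos hN1 (by linarith)
    -- For `k ≥ N` the function lies in `Σ_k` itself; for `k < N` zero is a good enough approximant
    -- since `k ^ α * N ^ (-α) ≤ 1`.
    · rcases le_or_gt N k with hNk | hkN
      · have h0 : (⨅ g ∈ networkFunctions d ℓ c k,
            eLpNorm (fun x => f x - g x) ∞ (cubeMeasure d)) = 0 := by
          refine le_antisymm ?_ zero_le
          refine (iInf₂_le f (networkFunctions_mono d hℓ_mono hc_mono hN hNk hf)).trans ?_
          simp only [sub_self]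
          exact eLpNorm_zero'.le
        rw [h0, mul_zero]
        exact zero_le
      · have h0 : (⨅ g ∈ networkFunctions d ℓ c k,
            eLpNorm (fun x => f x - g x) ∞ (cubeMeasure d))
              ≤ ENNReal.ofReal ((N : ℝ) ^ (-α)) := by
          refine (iInf₂_le _ (zero_mem_networkFunctions d c
            (one_le_two.trans (hℓ k hk)))).trans ?_
          simpa using hnorm
        calc (k : ℝ≥0∞) ^ α * _ ≤ (k : ℝ≥0∞) ^ α * ENNReal.ofReal ((N : ℝ) ^ (-α)) := by
              gcongr
          _ = ENNReal.ofReal ((k : ℝ) ^ α * (N : ℝ) ^ (-α)) := by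
              rw [natCast_rpow_eq_ofReal hk, ENNReal.ofReal_mul (by positivity)]
          _ ≤ 1 := by
              rw [ENNReal.ofReal_le_one, Real.rpow_neg (by positivity), ← div_eq_mul_inv,
                div_le_one (by positivity)]
              exact Real.rpow_le_rpow (by positivity) (by exact_mod_cast hkN.le) hα.le
  refine (iInf₂_le (1 : ℝ) ⟨one_pos, hpre⟩).trans ?_
  simp

/-! ### Lower bounds for randomized algorithms -/

theorem ofReal_abs_le_eLpNorm {d : ℕ} {g : (Fin d → ℝ) → ℝ} (hg : ContinuousOn g (cube d))
    {x : Fin d → ℝ} (hx : x ∈ cube d) :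
    ENNReal.ofReal |g x| ≤ eLpNorm g ∞ (cubeMeasure d) := by
  by_cases htop : eLpNorm g ∞ (cubeMeasure d) = ∞
  · rw [htop]
    exact le_top
  · rw [← ENNReal.ofReal_toReal htop]
    exact ENNReal.ofReal_le_ofReal
      (abs_le_of_eLpNorm_le hg ENNReal.toReal_nonneg (ENNReal.ofReal_toReal htop).ge hx)

/-- No output is close to both `f` and `-f`, which are at distance `2 * ‖f‖`. -/
theorem ofReal_two_mul_le_errorAt_add {d : ℕ} (y : LInfty d) {f : (Fin d → ℝ) → ℝ}
    (hf : ContinuousOn f (cube d)) {h : ℝ} {x : Fin d → ℝ} (hx : x ∈ cube d)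
    (hfx : h ≤ |f x|) :
    ENNReal.ofReal (2 * h) ≤ errorAt y f + errorAt y (fun x => - f x) := by
  have hfm : AEStronglyMeasurable f (cubeMeasure d) :=
    hf.aestronglyMeasurable measurableSet_Icc
  have hym : AEStronglyMeasurable y (cubeMeasure d) := Lp.aestronglyMeasurable y
  have h1 := eLpNorm_sub_le (hym.sub hfm.neg) (hym.sub hfm) (p := ∞) le_top
  have h2 : ((y : (Fin d → ℝ) → ℝ) - -f) - ((y : (Fin d → ℝ) → ℝ) - f)
      = fun x => 2 * f x := by
    funext x
    simp only [Pi.sub_apply, Pi.neg_apply]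
    ring
  rw [h2] at h1
  refine le_trans ?_ (h1.trans_eq (add_comm _ _))
  refine le_trans (ENNReal.ofReal_le_ofReal ?_)
    (ofReal_abs_le_eLpNorm (g := fun x => 2 * f x) (continuousOn_const.mul hf) hx)
  rw [abs_mul, abs_two]
  linarith

/-- The error is a continuous function of the output in `L^∞`. Measurability is needed to split
integrals of sums. -/
theorem measurable_errorAt {d : ℕ} {U : Set ((Fin d → ℝ) → ℝ)} {m : ℕ}
    (R : RandomizedAlg.{u} U m) (f : U) (hf : ContinuousOn f.1 (cube d)) :
    @Measurable R.Ω ℝ≥0∞ R.measurableSpace _ fun ω => errorAt (R.A ω f) f.1 := by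
  let := R.measurableSpace
  let : MeasurableSpace (LInfty d) := borel _
  have : BorelSpace (LInfty d) := ⟨rfl⟩
  have hF := memLp_of_continuousOn hf
  have h : ∀ y : LInfty d, errorAt y f.1 = ‖y - hF.toLp‖ₑ := by
    intro y
    rw [Lp.enorm_def]
    refine eLpNorm_congr_ae ?_
    filter_upwards [Lp.coeFn_sub y hF.toLp, hF.coeFn_toLp] with x h1 h2
    rw [h1, Pi.sub_apply, h2]
  simp only [h]
  have hc : Continuous fun y : LInfty d => ‖y - hF.toLp‖ₑ := by fun_prop
  exact hc.measurable.comp (R.measurable_A f)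

/-- If `U` contains `± f i` for a finite family of at least `2 m` functions with disjoint
supports and maximum at least `h`, then `m` random samples give error at least `h / 2`. -/
theorem ofReal_half_le_mcError {d : ℕ} {U : Set ((Fin d → ℝ) → ℝ)} {ι : Type*} [Fintype ι]
    (f : ι → (Fin d → ℝ) → ℝ) (hpos : ∀ i, f i ∈ U) (hneg : ∀ i, (fun x => - f i x) ∈ U)
    (hcont : ∀ i, ContinuousOn (f i) (cube d))
    (hdisj : ∀ x i i', f i x ≠ 0 → f i' x ≠ 0 → i = i') {h : ℝ} (hh : 0 ≤ h)
    (hpeak : ∀ i, ∃ x ∈ cube d, h ≤ |f i x|) {m : ℕ} (hm : 1 ≤ m)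
    (hcard : 2 * m ≤ Fintype.card ι) :
    ENNReal.ofReal (h / 2) ≤ mcError.{u} U m := by
  classical
  refine le_iInf fun R => ?_
  let := R.measurableSpace
  have := R.isProbabilityMeasure
  set M := Fintype.card ι with hM
  let p : ι → U := fun i => ⟨f i, hpos i⟩
  let q : ι → U := fun i => ⟨fun x => - f i x, hneg i⟩
  have hpm : ∀ i, Measurable fun ω => errorAt (R.A ω (p i)) (p i).1 :=
    fun i => measurable_errorAt R _ (hcont i)
  have hqm : ∀ i, Measurable fun ω => errorAt (R.A ω (q i)) (q i).1 :=
    fun i => measurable_errorAt R _ (hcont i).neg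
  have hpqm : ∀ i, Measurable fun ω =>
      errorAt (R.A ω (p i)) (p i).1 + errorAt (R.A ω (q i)) (q i).1 :=
    fun i => (hpm i).add (hqm i)
  -- By disjointness each sample point meets at most one support. A function missed by all samples
  -- is indistinguishable from its negative, so the two errors sum to at least `2 * h`. The deficit
  -- is linear in the number of samples, so only its expectation matters.
  have hpt : ∀ ω, (M : ℝ≥0∞) * ENNReal.ofReal (2 * h)
      ≤ ∑ i, (errorAt (R.A ω (p i)) (p i).1 + errorAt (R.A ω (q i)) (q i).1)
        + R.numSamples ω * ENNReal.ofReal (2 * h) := by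
    intro ω
    obtain ⟨x, hx, Q, hQ⟩ := R.mem_alg ω
    set T : Finset ι := Finset.univ.filter fun i => ∃ k, f i (x k) ≠ 0 with hT
    have hTcard : T.card ≤ R.numSamples ω := by
      have hsub : T ⊆ (Finset.univ : Finset (Fin (R.numSamples ω))).biUnion
          fun k => Finset.univ.filter fun i => f i (x k) ≠ 0 := by
        intro i hi
        simpa [hT] using hi
      refine (Finset.card_le_card hsub).trans ?_
      refine (Finset.card_biUnion_le_card_mul _ _ 1 fun k _ => ?_).trans_eq (by simp)
      refine Finset.card_le_one.2 fun i hi i' hi' => ?_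
      exact hdisj _ i i' (Finset.mem_filter.1 hi).2 (Finset.mem_filter.1 hi').2
    have hmiss : ∀ i ∈ Tᶜ, ENNReal.ofReal (2 * h)
        ≤ errorAt (R.A ω (p i)) (p i).1 + errorAt (R.A ω (q i)) (q i).1 := by
      intro i hi
      have h0 : ∀ k, f i (x k) = 0 := by simpa [hT] using hi
      have hEq : R.A ω (p i) = R.A ω (q i) := by
        rw [hQ, hQ]
        simp [p, q, h0]
      rw [← hEq]
      obtain ⟨z, hz, hfz⟩ := hpeak i
      exact ofReal_two_mul_le_errorAt_add _ (hcont i) hz hfz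
    have hMT : (M : ℝ≥0∞) = Tᶜ.card + T.card := by
      rw [hM, ← Finset.card_compl_add_card T]
      push_cast
      rfl
    rw [hMT, add_mul]
    gcongr
    · rw [← nsmul_eq_mul]
      refine (Finset.card_nsmul_le_sum _ _ _ hmiss).trans ?_
      exact Finset.sum_le_sum_of_subset (Finset.subset_univ _)
  have hint : (M : ℝ≥0∞) * ENNReal.ofReal (2 * h)
      ≤ M * (2 * R.error) + m * ENNReal.ofReal (2 * h) := by
    calc (M : ℝ≥0∞) * ENNReal.ofReal (2 * h)
        = ∫⁻ _, (M : ℝ≥0∞) * ENNReal.ofReal (2 * h) ∂(R.P) := by simp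
      _ ≤ ∫⁻ ω, (∑ i, (errorAt (R.A ω (p i)) (p i).1 + errorAt (R.A ω (q i)) (q i).1)
            + R.numSamples ω * ENNReal.ofReal (2 * h)) ∂(R.P) := lintegral_mono hpt
      _ = ∑ i, (∫⁻ ω, errorAt (R.A ω (p i)) (p i).1 ∂(R.P)
            + ∫⁻ ω, errorAt (R.A ω (q i)) (q i).1 ∂(R.P))
            + (∫⁻ ω, R.numSamples ω ∂(R.P)) * ENNReal.ofReal (2 * h) := by
          rw [lintegral_add_left (Finset.measurable_fun_sum _ fun i _ => hpqm i),
            lintegral_finsetSum _ fun i _ => hpqm i,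
            lintegral_mul_const' _ _ ENNReal.ofReal_ne_top]
          simp only [lintegral_add_left (hpm _)]
      _ ≤ ∑ _i : ι, (R.error + R.error) + m * ENNReal.ofReal (2 * h) := by
          gcongr with i
          · exact le_iSup (fun f : U => ∫⁻ ω, errorAt (R.A ω f) f.1 ∂(R.P)) (p i)
          · exact le_iSup (fun f : U => ∫⁻ ω, errorAt (R.A ω f) f.1 ∂(R.P)) (q i)
          · exact R.expectation_le
      _ = _ := by simp [hM, two_mul, mul_add]
  by_cases htop : R.error = ∞
  · rw [htop]
    exact le_top
  rw [← ENNReal.ofReal_toReal htop] at hint ⊢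
  set e := R.error.toReal
  have he : 0 ≤ e := ENNReal.toReal_nonneg
  have hreal : (M : ℝ) * (2 * h) ≤ M * (2 * e) + m * (2 * h) := by
    rw [← ENNReal.ofReal_natCast, ← ENNReal.ofReal_natCast,
      ← ENNReal.ofReal_mul (by positivity), ← ENNReal.ofReal_mul (by positivity),
      show (2 : ℝ≥0∞) = ENNReal.ofReal 2 by norm_num, ← ENNReal.ofReal_mul (by positivity),
      ← ENNReal.ofReal_mul (by positivity), ← ENNReal.ofReal_add (by positivity)
      (by positivity), ENNReal.ofReal_le_ofReal_iff (by positivity)] at hint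
    exact hint
  refine ENNReal.ofReal_le_ofReal ?_
  have hcard' : (2 : ℝ) * m ≤ M := by exact_mod_cast hcard
  have hM0 : (0 : ℝ) < M := by
    have : (1 : ℝ) ≤ m := by exact_mod_cast hm
    linarith
  -- Since `2 * m ≤ M`, the sampled functions account for at most half of `M * (2 * h)`.
  have h3 : (M : ℝ) * h ≤ M * (2 * e) := by nlinarith
  have := le_of_mul_le_mul_left h3 hM0
  linarith

/-- The centers of the cells of the uniform grid with `K ^ d` cells. -/
noncomputable def cellCenter {d K : ℕ} (i : Fin d → Fin K) : Fin d → ℝ := fun j => ((i j : ℕ) + 1 / 2) / K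

theorem cellCenter_mem_cube {d K : ℕ} (hK : 1 ≤ K) (i : Fin d → Fin K) :
    cellCenter i ∈ cube d := by
  have hK0 : (0 : ℝ) < K := by exact_mod_cast hK
  refine ⟨fun j => ?_, fun j => ?_⟩
  · simp only [cellCenter, Pi.zero_apply]
    positivity
  · simp only [cellCenter, Pi.one_apply]
    have h : (((i j : ℕ) : ℝ)) + 1 ≤ K := by exact_mod_cast (i j).2
    rw [div_le_one hK0]
    linarith

/-- The radius is half the cell width, so `bump B r` is nonzero only inside the open cell, which
determines the integers `i j` from `K * x j`. -/
theorem bump_cellCenter_disjoint {d K : ℕ} (hK : 1 ≤ K) (B : ℝ) (x : Fin d → ℝ)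
    (i i' : Fin d → Fin K) (h : bump B (1 / (2 * K)) (cellCenter i) x ≠ 0)
    (h' : bump B (1 / (2 * K)) (cellCenter i') x ≠ 0) : i = i' := by
  have hK0 : (0 : ℝ) < K := by exact_mod_cast hK
  have key : ∀ i : Fin d → Fin K, bump B (1 / (2 * K)) (cellCenter i) x ≠ 0 →
      ∀ j, ((i j : ℕ) : ℝ) < K * x j ∧ K * x j < (i j : ℕ) + 1 := by
    intro i h j
    have h1 : |x j - cellCenter i j| < 1 / (2 * K) := by
      by_contra hcon
      exact h (bump_eq_zero B (not_lt.1 hcon))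
    rw [abs_lt] at h1
    have e1 : (K : ℝ) * cellCenter i j = (i j : ℕ) + 1 / 2 := by
      rw [cellCenter]
      field_simp
    have e2 : (K : ℝ) * (1 / (2 * K)) = 1 / 2 := by field_simp
    have h2 := mul_lt_mul_of_pos_left h1.1 hK0
    have h3 := mul_lt_mul_of_pos_left h1.2 hK0
    constructor <;> linarith
  funext j
  have h1 := key i h j
  have h2 := key i' h' j
  have h3 : (i j : ℕ) < (i' j : ℕ) + 1 := by exact_mod_cast h1.1.trans h2.2
  have h4 : (i' j : ℕ) < (i j : ℕ) + 1 := by exact_mod_cast h2.1.trans h1.2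
  exact Fin.ext (by omega)

/-! ### The optimal order -/

/-- Cones of slope `B` on `K ^ d` cells have height `B / (2 * K)`. With `K = ⌈B * N ^ α⌉` it is at
most `N ^ (-α)`, which puts them in the unit ball, and at least `N ^ (-α) / 4`; the error is at
least half of that. -/
theorem ofReal_le_mcError_unitBall {d : ℕ} (hd : 1 ≤ d) {α : ℝ} (hα : 0 < α) {ℓ c : ℕ → ℕ∞}
    (hℓ_mono : MonotoneOn ℓ (Set.Ici 1)) (hℓ : ∀ n : ℕ, 1 ≤ n → 2 ≤ ℓ n)
    (hc_mono : MonotoneOn c (Set.Ici 1)) {j n N w : ℕ} (hn : 1 ≤ n)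
    (hN : N = (2 * d * d + 4 * d + 2 * j + 3) * n) (hw : 1 ≤ w) (hcN : c N = w)
    (hℓN : ((j + 3 : ℕ) : ℕ∞) ≤ ℓ N) {m : ℕ} (hm : 1 ≤ m)
    (hmK : 2 * m ≤ ⌈(w : ℝ) ^ (j + 3) * (n : ℝ) ^ ((j + 3) / 2) * (N : ℝ) ^ α⌉₊ ^ d) :
    ENNReal.ofReal ((N : ℝ) ^ (-α) / 8) ≤ mcError.{u} (unitBall d α ℓ c) m := by
  set B : ℝ := (w : ℝ) ^ (j + 3) * (n : ℝ) ^ ((j + 3) / 2) with hB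
  set K := ⌈B * (N : ℝ) ^ α⌉₊ with hK
  have hw1 : (1 : ℝ) ≤ w := by exact_mod_cast hw
  have hn1 : (1 : ℝ) ≤ n := by exact_mod_cast hn
  have hN1 : 1 ≤ N := by
    rw [hN]
    exact Nat.one_le_iff_ne_zero.2 (by positivity)
  have hN1' : (1 : ℝ) ≤ N := by exact_mod_cast hN1
  have hB2 : (w : ℝ) ^ 2 * n ≤ B := by
    have h1 : 1 ≤ (w : ℝ) ^ (j + 1) := one_le_pow₀ hw1
    have h2 : 1 ≤ (n : ℝ) ^ ((j + 1) / 2) := one_le_pow₀ hn1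
    have h3 : (j + 3) / 2 = (j + 1) / 2 + 1 := by omega
    calc (w : ℝ) ^ 2 * n = (w : ℝ) ^ 2 * n * (1 * 1) := by ring
      _ ≤ (w : ℝ) ^ 2 * n * ((w : ℝ) ^ (j + 1) * (n : ℝ) ^ ((j + 1) / 2)) := by gcongr
      _ = B := by
          rw [hB, h3]
          ring
  have hB1 : 1 ≤ B := by
    have : 1 ≤ (w : ℝ) ^ 2 := one_le_pow₀ hw1
    nlinarith
  have hNα : 1 ≤ (N : ℝ) ^ α := Real.one_le_rpow hN1' hα.le
  have hKlow : B * (N : ℝ) ^ α ≤ K := Nat.le_ceil _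
  have hKup : (K : ℝ) ≤ 2 * (B * (N : ℝ) ^ α) := by
    have := Nat.ceil_lt_add_one (show 0 ≤ B * (N : ℝ) ^ α by positivity)
    have : 1 ≤ B * (N : ℝ) ^ α := one_le_mul_of_one_le_of_one_le hB1 hNα
    linarith
  have hBK : B ≤ K := (le_mul_of_one_le_right (by linarith) hNα).trans hKlow
  have hK1 : 1 ≤ K := by exact_mod_cast hB1.trans hBK
  have hK0 : (0 : ℝ) < K := by exact_mod_cast hK1
  set r : ℝ := 1 / (2 * K) with hr
  have hr0 : 0 ≤ r := by positivity
  have hneg : (N : ℝ) ^ (-α) = ((N : ℝ) ^ α)⁻¹ := Real.rpow_neg (by positivity) α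
  have hheight : B * r ≤ (N : ℝ) ^ (-α) := by
    rw [hr, hneg, mul_one_div, div_le_iff₀ (by positivity), ← div_eq_inv_mul,
      le_div_iff₀ (by positivity)]
    linarith
  have hlow : (N : ℝ) ^ (-α) / 4 ≤ B * r := by
    rw [hr, hneg, mul_one_div, div_le_div_iff₀ (by norm_num) (by positivity),
      ← div_eq_inv_mul, div_le_iff₀ (by positivity)]
    linarith
  -- The bias in the cone network is at most `K * r = 1 / 2`, because `w ^ 2 * n ≤ B ≤ K`.
  have hwr : ((w : ℝ≥0) : ℝ) ^ 2 * n * r ≤ ((w : ℝ≥0) : ℝ) := by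
    have h1 : (w : ℝ) ^ 2 * n * r ≤ K * r := by
      gcongr
      exact hB2.trans hBK
    have h2 : (K : ℝ) * r = 1 / 2 := by
      rw [hr]
      field_simp
    rw [NNReal.coe_natCast]
    linarith
  have hmem : ∀ σ : ℝ, |σ| = 1 → ∀ i : Fin d → Fin K,
      bump (σ * B) r (cellCenter i) ∈ unitBall d α ℓ c := by
    intro σ hσ i
    refine mem_unitBall_of_mem_networkFunctions hα hℓ_mono hℓ hc_mono hN1 ?_ fun x _ => ?_
    · obtain ⟨Φ, hD, hW, hS, hR⟩ := exists_network_bump hd hn (w : ℝ≥0) hσ.le j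
        (cellCenter_mem_cube hK1 i) hr0 hwr
      refine ⟨Φ, hW.trans_eq hN.symm, by rwa [hD], ?_, funext fun x => ?_⟩
      · rw [hcN]
        have : (Φ.weightSize : ℝ≥0∞) ≤ ((w : ℝ≥0) : ℝ≥0∞) := by exact_mod_cast hS
        simpa using this
      · rw [hR x, NNReal.coe_natCast]
    · refine (abs_bump_le hr0 x _).trans ?_
      rwa [abs_mul, hσ, one_mul, abs_of_nonneg (by linarith)]
  have hmain := ofReal_half_le_mcError.{u} (U := unitBall d α ℓ c)
    (fun i : Fin d → Fin K => bump B r (cellCenter i))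
    (fun i => by simpa using hmem 1 abs_one i)
    (fun i => by
      have h := hmem (-1) (by simp) i
      unfold bump at h ⊢
      simpa only [neg_mul, one_mul] using h)
    (fun i => (continuous_bump _ _ _).continuousOn)
    (fun x i i' h h' => bump_cellCenter_disjoint hK1 B x i i' h h')
    (h := B * r) (by positivity)
    (fun i => ⟨cellCenter i, cellCenter_mem_cube hK1 i, by
      rw [bump_self B hr0]
      exact le_abs_self _⟩) hm (by simpa using hmK)
  refine le_trans (ENNReal.ofReal_le_ofReal ?_) hmain
  linarith

/-- At about `m ≈ N ^ (s * d)` samples the error is at least of order `N ^ (-α)` and at most of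
order `m ^ (-r)`. As `N` grows this forces `s * d * r ≤ α`. The loss `(j + 3) * ε` in `s` arises
from the lower bound `w ≥ C₁ * N ^ (θ - ε)` raised to the depth. -/
theorem order_mul_le {d : ℕ} (hd : 1 ≤ d) {α : ℝ} (hα : 0 < α) {ℓ c : ℕ → ℕ∞}
    (hℓ_mono : MonotoneOn ℓ (Set.Ici 1)) (hℓ : ∀ n : ℕ, 1 ≤ n → 2 ≤ ℓ n)
    (hc_mono : MonotoneOn c (Set.Ici 1)) (hc : ∀ n : ℕ, 1 ≤ n → 1 ≤ c n) {θ κ : ℝ}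
    (hc_growth : HasGrowth c θ κ) {j : ℕ} {n₀ : ℕ} (hn₀ : 1 ≤ n₀)
    (hdepth : ((j + 3 : ℕ) : ℕ∞) ≤ ℓ n₀) {r C : ℝ} (hr : 0 ≤ r) (hC : 0 < C)
    (herr : ∀ m : ℕ, 1 ≤ m → mcError.{u} (unitBall d α ℓ c) m
      ≤ ENNReal.ofReal (C * (m : ℝ) ^ (-r))) {ε : ℝ} (hε : 0 < ε) :
    (gammaStar θ (j + 3) - (j + 3 : ℕ) * ε + α) * d * r ≤ α := by
  obtain ⟨C₁, C₂, hC₁, -, hb⟩ := hc_growth.exists_bounds hε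
  set D := 2 * d * d + 4 * d + 2 * j + 3 with hD
  have hD0 : (0 : ℝ) < D := by positivity
  set s := gammaStar θ (j + 3) - (j + 3 : ℕ) * ε + α with hs
  set k := (j + 3) / 2 with hk
  set c₁ : ℝ := C₁ ^ (j + 3) / (D : ℝ) ^ k with hc₁
  have hc₁0 : 0 < c₁ := by positivity
  set E : ℝ := 8 * (C * (c₁ ^ d / 4) ^ (-r)) with hE
  have key : ∀ n : ℕ, n₀ ≤ n → ((D * n : ℕ) : ℝ) ^ (s * d * r - α) ≤ E := by
    intro n hn
    have hn1 : 1 ≤ n := hn₀.trans hn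
    set N := D * n with hN
    have hDN : n ≤ N := Nat.le_mul_of_pos_left n (by omega)
    have hN2 : 2 ≤ N := by
      have : 3 * 1 ≤ D * n := Nat.mul_le_mul (by omega) hn1
      omega
    have hN1 : 1 ≤ N := by omega
    have hNr : (1 : ℝ) < N := by exact_mod_cast hN2
    have hN0 : (0 : ℝ) < N := by linarith
    obtain ⟨w, hw, hwlow, -⟩ := hb N hN1
    have hw1 : 1 ≤ w := by
      have := hc N hN1
      rw [hw] at this
      exact_mod_cast this
    have hw1' : (1 : ℝ) ≤ w := by exact_mod_cast hw1
    have hn1' : (1 : ℝ) ≤ n := by exact_mod_cast hn1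
    have hℓN : ((j + 3 : ℕ) : ℕ∞) ≤ ℓ N := hdepth.trans (hℓ_mono hn₀ hN1 (hn.trans hDN))
    set K := ⌈(w : ℝ) ^ (j + 3) * (n : ℝ) ^ k * (N : ℝ) ^ α⌉₊ with hK
    have hKlow : (w : ℝ) ^ (j + 3) * (n : ℝ) ^ k * (N : ℝ) ^ α ≤ K := Nat.le_ceil _
    have hK2 : 2 ≤ K := by
      have h1 : 1 < (N : ℝ) ^ α := Real.one_lt_rpow hNr hα
      have h2 : 1 ≤ (w : ℝ) ^ (j + 3) * (n : ℝ) ^ k :=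
        one_le_mul_of_one_le_of_one_le (one_le_pow₀ hw1') (one_le_pow₀ hn1')
      have h3 : (1 : ℝ) < K := by nlinarith
      exact_mod_cast h3
    have hKd : 2 ≤ K ^ d := hK2.trans (Nat.le_self_pow (by omega) K)
    -- The largest sample number that the lower bound permits; `K ^ d ≥ 2` makes it positive and
    -- comparable to `K ^ d`.
    set m := K ^ d / 2 with hm
    have hm1 : 1 ≤ m := by omega
    have hmK : 2 * m ≤ K ^ d := by omega
    have hKm : K ^ d ≤ 4 * m := by omega
    have h1 := (ofReal_le_mcError_unitBall.{u} hd hα hℓ_mono hℓ hc_mono hn1 hN hw1 hw hℓN hm1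
      hmK).trans (herr m hm1)
    rw [ENNReal.ofReal_le_ofReal_iff (by positivity)] at h1
    have h2 : c₁ * (N : ℝ) ^ s ≤ K := by
      refine le_trans ?_ hKlow
      have e1 : C₁ ^ (j + 3) * (N : ℝ) ^ ((θ - ε) * (j + 3 : ℕ)) ≤ (w : ℝ) ^ (j + 3) := by
        rw [Real.rpow_mul_natCast hN0.le, ← mul_pow]
        exact pow_le_pow_left₀ (by positivity) hwlow _
      have e2 : (n : ℝ) ^ k = (N : ℝ) ^ (k : ℝ) / (D : ℝ) ^ k := by
        rw [Real.rpow_natCast, hN, Nat.cast_mul, mul_pow]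
        field_simp
      calc c₁ * (N : ℝ) ^ s
          = C₁ ^ (j + 3) * (N : ℝ) ^ ((θ - ε) * (j + 3 : ℕ))
              * ((N : ℝ) ^ (k : ℝ) / (D : ℝ) ^ k) * (N : ℝ) ^ α := by
            have e3 : s = (θ - ε) * (j + 3 : ℕ) + k + α := by
              rw [hs, gammaStar]
              ring
            rw [e3, Real.rpow_add hN0, Real.rpow_add hN0, hc₁]
            ring
        _ ≤ _ := by
            rw [e2]
            gcongr
    have h3 : c₁ ^ d / 4 * (N : ℝ) ^ (s * d) ≤ m := by
      have e1 : (c₁ * (N : ℝ) ^ s) ^ d ≤ (K : ℝ) ^ d := pow_le_pow_left₀ (by positivity) h2 d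
      have e2 : (K : ℝ) ^ d ≤ 4 * m := by exact_mod_cast hKm
      rw [mul_pow, ← Real.rpow_mul_natCast hN0.le] at e1
      linarith
    have h4 : (m : ℝ) ^ (-r) ≤ (c₁ ^ d / 4) ^ (-r) * (N : ℝ) ^ (-(s * d * r)) := by
      calc (m : ℝ) ^ (-r) ≤ (c₁ ^ d / 4 * (N : ℝ) ^ (s * d)) ^ (-r) :=
            Real.rpow_le_rpow_of_nonpos (by positivity) h3 (by linarith)
        _ = _ := by
            rw [Real.mul_rpow (by positivity) (by positivity), ← Real.rpow_mul hN0.le]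
            ring_nf
    have h5 : (N : ℝ) ^ (-α) ≤ E * (N : ℝ) ^ (-(s * d * r)) := by
      have := mul_le_mul_of_nonneg_left h4 hC.le
      rw [hE]
      linarith
    rw [sub_eq_add_neg, Real.rpow_add hN0]
    calc (N : ℝ) ^ (s * d * r) * (N : ℝ) ^ (-α)
        ≤ (N : ℝ) ^ (s * d * r) * (E * (N : ℝ) ^ (-(s * d * r))) := by gcongr
      _ = E := by
          rw [Real.rpow_neg hN0.le]
          have : (N : ℝ) ^ (s * d * r) ≠ 0 := by positivity
          field_simp
  by_contra hcon
  have hpos : 0 < s * d * r - α := by linarith [not_le.1 hcon]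
  have htend : Filter.Tendsto (fun n : ℕ => ((D * n : ℕ) : ℝ) ^ (s * d * r - α))
      Filter.atTop Filter.atTop :=
    (tendsto_rpow_atTop hpos).comp (tendsto_natCast_atTop_atTop.comp
      (Filter.tendsto_id.const_mul_atTop' (by omega)))
  obtain ⟨n, hn, hn'⟩ := ((htend.eventually_gt_atTop E).and
    (Filter.eventually_ge_atTop n₀)).exists
  exact absurd (key n hn') (not_le.2 hn)

theorem betaMC_unitBall_le {d : ℕ} (hd : 1 ≤ d) {α : ℝ} (hα : 0 < α) {ℓ c : ℕ → ℕ∞}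
    (hℓ_mono : MonotoneOn ℓ (Set.Ici 1)) (hℓ : ∀ n : ℕ, 1 ≤ n → 2 ≤ ℓ n)
    (hc_mono : MonotoneOn c (Set.Ici 1)) (hc : ∀ n : ℕ, 1 ≤ n → 1 ≤ c n) {θ κ : ℝ}
    (hθ : 0 ≤ θ) (hc_growth : HasGrowth c θ κ) {L : ℕ} (hL3 : 3 ≤ L)
    (hL : (L : ℕ∞) ≤ maxDepth ℓ) :
    betaMC.{u} (unitBall d α ℓ c)
      ≤ ENNReal.ofReal (1 / (d : ℝ) * (α / (gammaStar θ L + α))) := by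
  obtain ⟨j, rfl⟩ := Nat.exists_eq_add_of_le' hL3
  -- Depths are integers, so exceeding `j + 2` means reaching `j + 3`. Only `L ≤ maxDepth ℓ` is
  -- used, which also covers unbounded depth.
  obtain ⟨n₀, hn₀, hdepth⟩ : ∃ n₀ : ℕ, 1 ≤ n₀ ∧ ((j + 3 : ℕ) : ℕ∞) ≤ ℓ n₀ := by
    have h : ((j + 2 : ℕ) : ℕ∞) < maxDepth ℓ :=
      lt_of_lt_of_le (by exact_mod_cast Nat.lt_succ_self _) hL
    simp only [maxDepth, lt_iSup_iff] at h
    obtain ⟨n₀, hn₀, h⟩ := h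
    refine ⟨n₀, hn₀, ?_⟩
    have := Order.add_one_le_of_lt h
    exact_mod_cast this
  refine iSup₂_le fun r ⟨C, hC, herr⟩ => ?_
  have hγ0 : 0 ≤ gammaStar θ (j + 3) := by
    rw [gammaStar]
    positivity
  have hd0 : (0 : ℝ) < d := by exact_mod_cast hd
  have h : (gammaStar θ (j + 3) - (j + 3 : ℕ) * 0 + α) * d * r ≤ α := by
    have hcont : Continuous fun ε : ℝ =>
        (gammaStar θ (j + 3) - (j + 3 : ℕ) * ε + α) * d * r := by fun_prop
    refine le_of_tendsto ((hcont.tendsto 0).mono_left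
      (nhdsWithin_le_nhds (s := Set.Ioi 0))) ?_
    filter_upwards [self_mem_nhdsWithin] with ε hε
    exact order_mul_le hd hα hℓ_mono hℓ hc_mono hc hc_growth hn₀ hdepth r.2 hC herr hε
  rw [mul_zero, sub_zero] at h
  have h' : (r : ℝ) ≤ 1 / (d : ℝ) * (α / (gammaStar θ (j + 3) + α)) := by
    rw [one_div_mul_eq_div, div_div, le_div_iff₀ (by positivity)]
    linarith
  rw [← ENNReal.ofReal_coe_nnreal]
  exact ENNReal.ofReal_le_ofReal h'

/-- Depth `L = 2 * i` gives `γ* ≥ i` for every large `i`, so the order is at most `α / i`. -/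
theorem betaMC_unitBall_eq_zero {d : ℕ} (hd : 1 ≤ d) {α : ℝ} (hα : 0 < α) {ℓ c : ℕ → ℕ∞}
    (hℓ_mono : MonotoneOn ℓ (Set.Ici 1)) (hℓ : ∀ n : ℕ, 1 ≤ n → 2 ≤ ℓ n)
    (hc_mono : MonotoneOn c (Set.Ici 1)) (hc : ∀ n : ℕ, 1 ≤ n → 1 ≤ c n) {θ κ : ℝ}
    (hθ : 0 ≤ θ) (hc_growth : HasGrowth c θ κ) (hL : maxDepth ℓ = ⊤) :
    betaMC.{u} (unitBall d α ℓ c) = 0 := by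
  have hd1 : (1 : ℝ) ≤ d := by exact_mod_cast hd
  refine le_antisymm ?_ zero_le
  have hlim := ENNReal.tendsto_ofReal (tendsto_const_div_atTop_nhds_zero_nat α)
  rw [ENNReal.ofReal_zero] at hlim
  refine ge_of_tendsto hlim ?_
  filter_upwards [Filter.eventually_ge_atTop 3] with i hi
  refine (betaMC_unitBall_le hd hα hℓ_mono hℓ hc_mono hc hθ hc_growth
    (L := 2 * i) (by omega) (by simp [hL])).trans (ENNReal.ofReal_le_ofReal ?_)
  have hi0 : (0 : ℝ) < i := by
    have : 0 < i := by omega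
    exact_mod_cast this
  have hγ : (i : ℝ) ≤ gammaStar θ (2 * i) := by
    have h : 2 * i / 2 = i := by omega
    rw [gammaStar, h]
    have : 0 ≤ θ * (2 * i : ℕ) := by positivity
    linarith
  have h1 : 1 / (d : ℝ) ≤ 1 := by
    rw [div_le_one (by linarith)]
    exact hd1
  calc 1 / (d : ℝ) * (α / (gammaStar θ (2 * i) + α))
      ≤ 1 * (α / i) := by
        gcongr ?_ * ?_
        · exact div_nonneg hα.le (by linarith)
        · exact div_le_div_of_nonneg_left hα.le hi0 (by linarith)
    _ = α / i := one_mul _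

end NNApprox

theorem theorem1p3 (d : ℕ) (hd : 1 ≤ d) (α : ℝ) (hα : 0 < α)
    (ℓ c : ℕ → ℕ∞)
    (hℓ_mono : MonotoneOn ℓ (Set.Ici 1)) (hℓ : ∀ n : ℕ, 1 ≤ n → 2 ≤ ℓ n)
    (hℓ_max : 3 ≤ NNApprox.maxDepth ℓ)
    (hc_mono : MonotoneOn c (Set.Ici 1)) (hc : ∀ n : ℕ, 1 ≤ n → 1 ≤ c n)
    (θ κ : ℝ) (hθ : 0 ≤ θ) (hc_growth : NNApprox.HasGrowth c θ κ) :
    (∀ m : ℕ, 2 ^ d ≤ m →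
      NNApprox.pwConst (NNApprox.unitBall d α ℓ c) m ∈
        NNApprox.Alg (NNApprox.unitBall d α ℓ c) m) ∧
    NNApprox.betaPwConst (NNApprox.unitBall d α ℓ c) = NNApprox.optimalRate d α θ ℓ ∧
    NNApprox.betaDet (NNApprox.unitBall d α ℓ c) = NNApprox.optimalRate d α θ ℓ ∧
    NNApprox.betaMC.{u} (NNApprox.unitBall d α ℓ c) = NNApprox.optimalRate d α θ ℓ := by

  have h_det := NNApprox.betaPwConst_le_betaDet hd α ℓ c
  have h_mc := NNApprox.betaDet_le_betaMC.{u} (NNApprox.unitBall d α ℓ c)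
  -- The chain of three orders collapses once its two ends are bounded by the same number.
  have h_squeeze : NNApprox.optimalRate d α θ ℓ
        ≤ NNApprox.betaPwConst (NNApprox.unitBall d α ℓ c) →
      NNApprox.betaMC.{u} (NNApprox.unitBall d α ℓ c) ≤ NNApprox.optimalRate d α θ ℓ →
      NNApprox.betaPwConst (NNApprox.unitBall d α ℓ c) = NNApprox.optimalRate d α θ ℓ ∧
      NNApprox.betaDet (NNApprox.unitBall d α ℓ c) = NNApprox.optimalRate d α θ ℓ ∧
      NNApprox.betaMC.{u} (NNApprox.unitBall d α ℓ c) = NNApprox.optimalRate d α θ ℓ :=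
    fun hlow hup => ⟨le_antisymm (h_det.trans (h_mc.trans hup)) hlow,
      le_antisymm (h_mc.trans hup) (hlow.trans h_det),
      le_antisymm hup (hlow.trans (h_det.trans h_mc))⟩
  refine ⟨fun m hm => NNApprox.pwConst_mem_Alg hd _ hm, ?_⟩
  by_cases htop : NNApprox.maxDepth ℓ = ⊤
  · have hrate : NNApprox.optimalRate d α θ ℓ = 0 := by simp [NNApprox.optimalRate, htop]
    refine h_squeeze (hrate ▸ zero_le) ?_
    rw [hrate]
    exact (NNApprox.betaMC_unitBall_eq_zero.{u} hd hα hℓ_mono hℓ hc_mono hc hθ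
      hc_growth htop).le
  · obtain ⟨L, hL⟩ := ENat.ne_top_iff_exists.1 htop
    have hrate : NNApprox.optimalRate d α θ ℓ
        = ENNReal.ofReal (1 / (d : ℝ) * (α / (NNApprox.gammaStar θ L + α))) := by
      rw [NNApprox.optimalRate, ← hL, if_pos (ENat.natCast_lt_top L), ENat.toNat_natCast]
    rw [hrate] at h_squeeze ⊢
    have hL3 : 3 ≤ L := by
      rw [← hL] at hℓ_max
      exact_mod_cast hℓ_max
    exact h_squeeze (NNApprox.ofReal_le_betaPwConst d hd hα hL.symm hc hθ hc_growth)
      (NNApprox.betaMC_unitBall_le hd hα hℓ_mono hℓ hc_mono hc hθ hc_growth hL3 hL.le)
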